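/- All matroids are finite. For a matroid $N$, we say that elements $e,f$ of a matroid $M$ are in an $N$-minor of $M$ together if $M$ has a minor that is isomorphic to $N$ and whose ground set contains both $e$ and $f$. A matroid $N$ has the transitivity property if, for every matroid $M$ and every three distinct elements $e,f,g\in E(M)$: if $e$ is in an $N$-minor of $M$ together with $f$, and $f$ is in an $N$-minor of $M$ together with $g$, then $e$ is in an $N$-minor of $M$ together with $g$. Let $U_{1,2}$ be the uniform matroid of rank $1$ on two elements, and let $M(\mathcal W_2)$ be the rank-$2$ wheel, that is, the cycle matroid of the graph $\mathcal W_2$ that has a hub, two rim vertices, one spoke from the hub to each rim vertex, and two parallel edges joining the rim vertices. **Theorem.** Let $N$ be a matroid with at least two elements. Then $N$ has the transitivity property if and only if $N\cong U_{1,2}$ or $N\cong M(\mathcal W_2)$. -/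

import Mathlib

universe u v

namespace MinorTransitivity

/-! ### Isomorphism, minors up to isomorphism, and the transitivity property -/

/-- Two matroids are isomorphic if there is a bijection between their ground sets under which
the independent sets of one correspond to the independent sets of the other. -/
def IsIso {α : Type u} {β : Type v} (M : Matroid α) (N : Matroid β) : Prop :=
  ∃ φ : M.E ≃ N.E, ∀ I : Set M.E,
    M.Indep (Subtype.val '' I) ↔ N.Indep (Subtype.val '' (φ '' I))

/-- The elements `e` and `f` of `M` are in an `N`-minor of `M` together: some minor of `M` that is
isomorphic to `N` uses both `e` and `f`. -/
def InMinorTogether {α : Type u} {β : Type v} (N : Matroid α) (M : Matroid β) (e f : β) : Prop :=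
  ∃ M' : Matroid β, M'.IsMinor M ∧ IsIso M' N ∧ e ∈ M'.E ∧ f ∈ M'.E

/-- `N` has the transitivity property if, for every (finite) matroid `M` and every triple of
distinct elements `e, f, g` of `M`, if `e` is in an `N`-minor with `f`, and `f` is in an `N`-minor
with `g`, then `e` is in an `N`-minor with `g`. -/
def HasTransitivityProperty {α : Type u} (N : Matroid α) : Prop :=
  ∀ (β : Type v) (M : Matroid β), M.Finite → ∀ e f g : β,
    e ∈ M.E → f ∈ M.E → g ∈ M.E → e ≠ f → f ≠ g → e ≠ g →
    InMinorTogether N M e f → InMinorTogether N M f g → InMinorTogether N M e g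

/-! ### Uniform matroids -/

/-- The uniform matroid `U_{r,n}`, on the ground set `Fin n`: the independent sets are the sets
with at most `r` elements. -/
def uniformMatroid (r n : ℕ) : Matroid (Fin n) :=
  (IndepMatroid.ofFinset Set.univ (fun I : Finset (Fin n) => I.card ≤ r)
    (by simp)
    (fun _ _ hJ hIJ => (Finset.card_le_card hIJ).trans hJ)
    (by
      intro I J _ hJ hIJ
      obtain ⟨e, heJ, heI⟩ := Finset.exists_mem_notMem_of_card_lt_card hIJ
      refine ⟨e, heJ, heI, ?_⟩
      rw [Finset.card_insert_of_notMem heI]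
      omega)
    (by simp)).matroid

/-! ### Cycles and forests of multigraphs, and the wheel of rank two -/

/-- `C` is the edge set of a cycle of the multigraph `G`: for some `k ≥ 1` there are distinct
vertices `x₀, …, xₖ₋₁` and distinct edges `c₀, …, cₖ₋₁` such that `cᵢ` joins `xᵢ` and `xᵢ₊₁`
(indices modulo `k`), and `C = {c₀, …, cₖ₋₁}`. So a loop is a cycle with `k = 1`, and a pair of
parallel edges is a cycle with `k = 2`. -/
def IsCycleEdgeSet {V : Type u} {E : Type v} (G : Graph V E) (C : Set E) : Prop :=
  ∃ (k : ℕ) (_ : NeZero k) (x : Fin k → V) (c : Fin k → E),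
    Function.Injective x ∧ Function.Injective c ∧
    (∀ i, G.IsLink (c i) (x i) (x (i + 1))) ∧ C = Set.range c

/-- `I` is the edge set of a forest of `G`: a set of edges that contains no cycle. -/
def IsForestEdgeSet {V : Type u} {E : Type v} (G : Graph V E) (I : Set E) : Prop :=
  I ⊆ G.edgeSet ∧ ∀ C ⊆ I, ¬ IsCycleEdgeSet G C

/-- The two ends of an edge of the wheel with `n` spokes. The vertices are the hub `none` and
the rim vertices `some i`; the edge `inl i` is the spoke at the rim vertex `i`, and the edge
`inr i` is the rim edge from the rim vertex `i` to the next one. -/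
def wheelEnds (n : ℕ) [NeZero n] : Fin n ⊕ Fin n → Sym2 (Option (Fin n))
  | Sum.inl i => s(none, some i)
  | Sum.inr i => s(some i, some (i + 1))

/-- The wheel `𝒲ₙ` with `n` spokes. For `n = 2` its rim is a pair of parallel edges. -/
def wheel (n : ℕ) [NeZero n] : Graph (Option (Fin n)) (Fin n ⊕ Fin n) where
  vertexSet := Set.univ
  edgeSet := Set.univ
  IsLink c x y := wheelEnds n c = s(x, y)
  isLink_symm _ _ := ⟨fun _ _ h => h.trans Sym2.eq_swap⟩
  eq_or_eq_of_isLink_of_isLink := by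
    intro c x y v w h h'
    rcases Sym2.eq_iff.1 (h.symm.trans h') with h | h
    · exact Or.inl h.1
    · exact Or.inr h.1
  edge_mem_iff_exists_isLink c := by
    refine ⟨fun _ => ?_, fun _ => Set.mem_univ c⟩
    cases c <;> exact ⟨_, _, rfl⟩
  left_mem_of_isLink _ x _ _ := Set.mem_univ x

/-- The forests of `𝒲₂` are the sets of at most two edges that do not contain both rim edges. -/
theorem isForestEdgeSet_wheel_two (I : Finset (Fin 2 ⊕ Fin 2)) :
    IsForestEdgeSet (wheel 2) (I : Set (Fin 2 ⊕ Fin 2)) ↔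
      I.card ≤ 2 ∧ ¬ (Sum.inr 0 ∈ I ∧ Sum.inr 1 ∈ I) := by
  constructor
  · rintro ⟨-, hI⟩
    have hrim : ¬ (Sum.inr 0 ∈ I ∧ Sum.inr 1 ∈ I) := by
      rintro ⟨h0, h1⟩
      refine hI (Set.range ![Sum.inr 0, Sum.inr 1]) ?_
        ⟨2, inferInstance, ![some 0, some 1], ![Sum.inr 0, Sum.inr 1], by decide, by decide, ?_, rfl⟩
      · rintro _ ⟨i, rfl⟩
        fin_cases i
        · exact h0
        · exact h1
      · change ∀ i : Fin 2, wheelEnds 2 (![Sum.inr 0, Sum.inr 1] i) = s(_, _)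
        decide
    have htri : ∀ j : Fin 2, ¬ (Sum.inl 0 ∈ I ∧ Sum.inr j ∈ I ∧ Sum.inl 1 ∈ I) := by
      rintro j ⟨h0, hj, h1⟩
      refine hI (Set.range ![Sum.inl 0, Sum.inr j, Sum.inl 1]) ?_
        ⟨3, inferInstance, ![none, some 0, some 1], ![Sum.inl 0, Sum.inr j, Sum.inl 1],
          by decide, by clear hj; revert j; decide, ?_, rfl⟩
      · rintro _ ⟨i, rfl⟩
        fin_cases i
        · exact h0
        · exact hj
        · exact h1
      · change ∀ i : Fin 3, wheelEnds 2 (![Sum.inl 0, Sum.inr j, Sum.inl 1] i) = s(_, _)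
        clear hj
        revert j
        decide
    refine ⟨?_, hrim⟩
    have h0 := htri 0
    have h1 := htri 1
    clear hI htri
    revert I
    decide
  · rintro ⟨hcard, hrim⟩
    refine ⟨Set.subset_univ _, ?_⟩
    rintro C hC ⟨k, hk, x, c, hx, hc, hlink, rfl⟩
    have hcI : ∀ i, c i ∈ I := fun i => hC ⟨i, rfl⟩
    have hkI : k ≤ 2 := by
      have h := Finset.card_le_card_of_injOn (s := Finset.univ) (t := I) c
        (fun i _ => hcI i) hc.injOn
      rw [Finset.card_univ, Fintype.card_fin] at h
      omega
    have hk0 : k ≠ 0 := hk.out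
    have key1 : ∀ (a : Fin 2 ⊕ Fin 2) (y : Option (Fin 2)), wheelEnds 2 a ≠ s(y, y) := by decide
    have key2 : ∀ (a b : Fin 2 ⊕ Fin 2), a ≠ b → wheelEnds 2 a = wheelEnds 2 b →
        (a = Sum.inr 0 ∧ b = Sum.inr 1) ∨ (a = Sum.inr 1 ∧ b = Sum.inr 0) := by decide
    obtain rfl | rfl : k = 1 ∨ k = 2 := by omega
    · exact key1 _ _ (hlink 0)
    · have e0 : wheelEnds 2 (c 0) = s(x 0, x 1) := hlink 0
      have e1 : wheelEnds 2 (c 1) = s(x 1, x 0) := hlink 1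
      have hne : c 0 ≠ c 1 := fun h => absurd (hc h) Fin.zero_ne_one
      rcases key2 _ _ hne (e0.trans (Sym2.eq_swap.trans e1.symm)) with ⟨h0, h1⟩ | ⟨h0, h1⟩
      · exact hrim ⟨h0 ▸ hcI 0, h1 ▸ hcI 1⟩
      · exact hrim ⟨h1 ▸ hcI 1, h0 ▸ hcI 0⟩

set_option synthInstance.maxHeartbeats 200000 in
set_option synthInstance.maxSize 1000 in
/-- The forests of `𝒲₂` are the independent sets of a matroid on the edge set. -/
theorem exists_matroid_wheel_two :
    ∃ M : Matroid (Fin 2 ⊕ Fin 2), (Set.univ : Set (Fin 2 ⊕ Fin 2)) = M.E ∧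
      ∀ I, M.Indep I ↔ IsForestEdgeSet (wheel 2) I := by
  refine ⟨(IndepMatroid.ofFinset Set.univ
    (fun I : Finset (Fin 2 ⊕ Fin 2) => I.card ≤ 2 ∧ ¬ (Sum.inr 0 ∈ I ∧ Sum.inr 1 ∈ I))
    (by decide)
    (fun _ _ hJ hIJ => ⟨(Finset.card_le_card hIJ).trans hJ.1,
      fun h => hJ.2 ⟨hIJ h.1, hIJ h.2⟩⟩)
    (by
      have key : ∀ I J : Finset (Fin 2 ⊕ Fin 2),
          (I.card ≤ 2 ∧ ¬ (Sum.inr 0 ∈ I ∧ Sum.inr 1 ∈ I)) →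
          (J.card ≤ 2 ∧ ¬ (Sum.inr 0 ∈ J ∧ Sum.inr 1 ∈ J)) → I.card < J.card →
          ∃ e ∈ J, e ∉ I ∧ ((insert e I).card ≤ 2 ∧
            ¬ (Sum.inr 0 ∈ insert e I ∧ Sum.inr 1 ∈ insert e I)) := by
        decide
      exact fun I J => key I J)
    (by simp)).matroid, rfl, ?_⟩
  intro I
  obtain ⟨J, rfl⟩ := (Set.toFinite I).exists_finset_coe
  rw [isForestEdgeSet_wheel_two]
  rw [IndepMatroid.matroid_Indep, IndepMatroid.ofFinset_indep]

/-- The rank-2 wheel `M(𝒲₂)`: the cycle matroid of the graph `𝒲₂`, whose ground set is the set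
of edges and whose independent sets are the edge sets of forests. -/
def wheelMatroidTwo : Matroid (Fin 2 ⊕ Fin 2) :=
  Matroid.ofExistsMatroid Set.univ (IsForestEdgeSet (wheel 2)) exists_matroid_wheel_two

end MinorTransitivity

-- Necessity. Transitivity passes to duals and to isomorphic copies, so each consequence may also be
-- used dually. Each comes from a test matroid in which two `N`-minors share an element. Replacing a
-- loop by two parallel copies shows that `N` has no loops (`rk_singleton`). Doubling an element in
-- parallel gives a rank-preserving self-map folding a parallel pair onto that element
-- (`exists_fold`), so parallel pairs exist. Two pencils of lines show that there is only one
-- nontrivial parallel class (`rk_of_parallel`). If that class is everything, the rank is one, and a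
-- series pair, which exists by duality, is the whole ground set: this is `U_{1,2}`, as is the dual
-- case. Otherwise there are a unique parallel pair {p, p'} and a unique series pair {q, k}, and
-- automorphisms of `N ＼ {p}` carry p' to every other element (`exists_bijOn_compl`). Comparing
-- series pairs of `N ＼ {p}` then leaves only p, p', q, k, forming the wheel.
--
-- Sufficiency. Both matroids are connected, so only connected `M` matter
-- (`hasTransitivityProperty_of_isConnected`), and there any two elements turn out to be together.
-- Elements other than these two can be deleted or contracted while staying connected
-- (`delete_or_contract`), which ends at `U_{1,2}`. For the wheel, nonuniformity is kept as well.
-- When it would be lost, then up to duality `M` is a one-element extension of a uniform matroid,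
-- where a small set spanning the new element yields the wheel directly.

universe w

namespace MinorTransitivity

open Set Matroid

/-! ### Natural-number rank and its behaviour under minors and duality. -/

section Rank

variable {α : Type u} {β : Type v} {M N : Matroid α} {X Y : Set α}

/-- The rank of a set as a natural number (meaningful in matroids of finite rank). -/
noncomputable def rk (M : Matroid α) (X : Set α) : ℕ := (M.eRk X).toNat

theorem cast_rk (M : Matroid α) [M.RankFinite] (X : Set α) : (rk M X : ℕ∞) = M.eRk X :=
  ENat.natCast_toNat ((M.isRkFinite_set X).eRk_lt_top).ne

theorem rk_mono (M : Matroid α) [M.RankFinite] (h : X ⊆ Y) : rk M X ≤ rk M Y := by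
  have := M.eRk_mono h
  rw [← cast_rk, ← cast_rk] at this
  exact_mod_cast this

theorem rk_submod (M : Matroid α) [M.RankFinite] (X Y : Set α) :
    rk M (X ∩ Y) + rk M (X ∪ Y) ≤ rk M X + rk M Y := by
  have := M.eRk_inter_add_eRk_union_le X Y
  simp only [← cast_rk] at this
  exact_mod_cast this

/-- A convenient form of submodularity. -/
theorem rk_submod_of_subset (M : Matroid α) [M.RankFinite] {A B : Set α} (hA : A ⊆ X ∩ Y)
    (hB : B ⊆ X ∪ Y) : rk M A + rk M B ≤ rk M X + rk M Y :=
  (Nat.add_le_add (rk_mono M hA) (rk_mono M hB)).trans (rk_submod M X Y)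

@[simp] theorem rk_empty (M : Matroid α) : rk M ∅ = 0 := by simp [rk]

theorem rk_singleton_le (M : Matroid α) [M.RankFinite] (e : α) : rk M {e} ≤ 1 := by
  have := M.eRk_singleton_le e
  rw [← cast_rk] at this
  exact_mod_cast this

theorem rk_union_le (M : Matroid α) [M.RankFinite] (X Y : Set α) :
    rk M (X ∪ Y) ≤ rk M X + rk M Y := by
  have := rk_submod M X Y
  omega

theorem rk_insert_le (M : Matroid α) [M.RankFinite] (e : α) (X : Set α) :
    rk M (insert e X) ≤ rk M X + 1 := by
  have h := rk_union_le M {e} X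
  have := rk_singleton_le M e
  rw [singleton_union] at h
  omega

theorem rk_le_ncard (M : Matroid α) [M.RankFinite] (hX : X.Finite) : rk M X ≤ X.ncard := by
  have := M.eRk_le_encard X
  rw [← cast_rk, ← hX.cast_ncard_eq] at this
  exact_mod_cast this

theorem indep_iff_rk (M : Matroid α) [M.RankFinite] (hX : X.Finite) :
    M.Indep X ↔ rk M X = X.ncard := by
  rw [indep_iff_eRk_eq_encard, ← cast_rk, ← hX.cast_ncard_eq]
  exact_mod_cast Iff.rfl

theorem exists_indep_ncard (M : Matroid α) [M.RankFinite] (X : Set α) :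
    ∃ I ⊆ X, M.Indep I ∧ I.Finite ∧ I.ncard = rk M X := by
  obtain ⟨I, hI⟩ := M.exists_isBasis' X
  have hf : I.Finite := hI.indep.finite
  refine ⟨I, hI.subset, hI.indep, hf, ?_⟩
  have := hI.encard_eq_eRk
  rw [← cast_rk, ← hf.cast_ncard_eq] at this
  exact_mod_cast this

theorem ncard_le_rk (M : Matroid α) [M.RankFinite] {I : Set α} (hI : M.Indep I) (hIX : I ⊆ X) :
    I.ncard ≤ rk M X := by
  rw [← (indep_iff_rk M hI.finite).1 hI]
  exact rk_mono M hIX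

theorem rk_inter_ground (M : Matroid α) (X : Set α) : rk M (X ∩ M.E) = rk M X := by
  simp [rk]

theorem rk_restrict (M : Matroid α) (R X : Set α) : rk (M ↾ R) X = rk M (X ∩ R) := by
  simp [rk, restrict_eRk_eq']

theorem rk_delete (M : Matroid α) (D X : Set α) : rk (M ＼ D) X = rk M (X \ D) := by
  rw [delete_eq_restrict, rk_restrict, ← rk_inter_ground M (X \ D)]
  congr 1
  ext; simp; tauto

theorem rk_comap (N : Matroid β) (f : α → β) (X : Set α) : rk (N.comap f) X = rk N (f '' X) := by
  simp [rk, eRk_comap]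

theorem rk_dual (M : Matroid α) [M.Finite] (hX : X ⊆ M.E) :
    rk M✶ X + rk M M.E = rk M (M.E \ X) + X.ncard := by
  have h := M.eRk_dual_add_eRank X hX
  rw [eRank_def, ← cast_rk, ← cast_rk, ← cast_rk, ← (M.ground_finite.subset hX).cast_ncard_eq] at h
  exact_mod_cast h

theorem rk_contract (M : Matroid α) [M.RankFinite] (C X : Set α) :
    rk (M ／ C) X + rk M C = rk M (X ∪ C) := by
  obtain ⟨J, hJ⟩ := M.exists_isBasis' C
  obtain ⟨I, hI, hJI⟩ := hJ.indep.subset_isBasis'_of_subset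
    (hJ.subset.trans (subset_union_right (s := X)))
  have hIC : I ∩ C = J :=
    (hJ.eq_of_subset_indep (hI.indep.inter_right C) (subset_inter hJI hJ.subset)
      inter_subset_right).symm
  have h2 := hI.contract_isBasis' hJ (hI.indep.subset (union_subset sdiff_subset hJI))
  have e1 := h2.encard_eq_eRk
  have e2 : (M ／ C).eRk ((X ∪ C) \ C) = (M ／ C).eRk X := by
    rw [← eRk_inter_ground, ← eRk_inter_ground _ X, contract_ground]
    congr 1
    ext; simp; tauto
  have hfin := hI.indep.finite
  have e3 : rk (M ／ C) X = (I \ C).ncard := by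
    rw [rk, ← e2, ← e1, ncard_def]
  have e4 : rk M C = J.ncard := by rw [rk, ← hJ.encard_eq_eRk, ncard_def]
  have e5 : rk M (X ∪ C) = I.ncard := by rw [rk, ← hI.encard_eq_eRk, ncard_def]
  rw [e3, e4, e5, ← hIC, add_comm, ncard_inter_add_ncard_sdiff_eq_ncard I C hfin]

theorem rk_minor (M : Matroid α) [M.RankFinite] {C D : Set α} (hX : X ⊆ (M ／ C ＼ D).E) :
    rk (M ／ C ＼ D) X + rk M C = rk M (X ∪ C) := by
  have : X \ D = X := by
    rw [sdiff_eq_left]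
    exact (disjoint_sdiff_left (s := D)).mono_left (by simpa using hX)
  rw [rk_delete, this, rk_contract]

theorem minor_finite [M.Finite] (h : N ≤m M) : N.Finite :=
  ⟨M.ground_finite.subset h.subset⟩

theorem eq_of_rk [M.Finite] [N.Finite] (hE : M.E = N.E)
    (h : ∀ X ⊆ M.E, rk M X = rk N X) : M = N := by
  refine ext_indep hE fun I hI => ?_
  rw [indep_iff_rk M (M.ground_finite.subset hI), indep_iff_rk N (M.ground_finite.subset hI), h I hI]

end Rank

/-! ### Isomorphisms, duality and transport of the transitivity property. -/

section Iso

variable {α : Type u} {β : Type v} {γ : Type w} {M : Matroid α} {N : Matroid β} {L : Matroid γ}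

theorem IsIso.symm (h : IsIso M N) : IsIso N M := by
  obtain ⟨φ, hφ⟩ := h
  refine ⟨φ.symm, fun I => ?_⟩
  have : φ '' (φ.symm '' I) = I := by rw [← image_comp]; simp
  rw [hφ (φ.symm '' I), this]

theorem IsIso.trans (h : IsIso M N) (h' : IsIso N L) : IsIso M L := by
  obtain ⟨φ, hφ⟩ := h
  obtain ⟨ψ, hψ⟩ := h'
  refine ⟨φ.trans ψ, fun I => ?_⟩
  rw [hφ, hψ]
  have : ψ '' (φ '' I) = (φ.trans ψ) '' I := by rw [← image_comp]; rfl
  rw [this]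

theorem isIso_of_bijOn (f : α → β) (hf : BijOn f M.E N.E)
    (h : ∀ I ⊆ M.E, M.Indep I ↔ N.Indep (f '' I)) : IsIso M N := by
  refine ⟨hf.equiv f, fun I => ?_⟩
  rw [h _ (by simp), ← image_comp, ← image_comp]
  rfl

theorem isIso_of_bijOn_rk [M.Finite] [N.Finite] (f : α → β) (hf : BijOn f M.E N.E)
    (h : ∀ X ⊆ M.E, rk M X = rk N (f '' X)) : IsIso M N := by
  refine isIso_of_bijOn f hf fun I hI => ?_
  have hfin := M.ground_finite.subset hI
  rw [indep_iff_rk M hfin, indep_iff_rk N (hfin.image f), h I hI,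
    (hf.injOn.mono hI).ncard_image]

theorem IsIso.exists_bijOn (h : IsIso M N) (hne : M.E.Nonempty) :
    ∃ f : α → β, BijOn f M.E N.E ∧ ∀ I ⊆ M.E, M.Indep I ↔ N.Indep (f '' I) := by
  classical
  obtain ⟨φ, hφ⟩ := h
  obtain ⟨e, he⟩ := hne
  -- The value off `M.E` is irrelevant; a nonempty ground set is needed only to supply one.
  let f : α → β := fun x => if hx : x ∈ M.E then (φ ⟨x, hx⟩ : β) else φ ⟨e, he⟩
  have hfx : ∀ x : M.E, f x = φ x := fun x => by simp [f]
  refine ⟨f, ⟨fun x hx => ?_, fun x hx y hy hxy => ?_, fun y hy => ?_⟩, fun I hI => ?_⟩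
  · simp [f, hx]
  · have := (hfx ⟨x, hx⟩).symm.trans (hxy.trans (hfx ⟨y, hy⟩))
    simpa using φ.injective (Subtype.ext this)
  · refine ⟨φ.symm ⟨y, hy⟩, (φ.symm ⟨y, hy⟩).2, ?_⟩
    rw [hfx]; simp
  · have := hφ (Subtype.val ⁻¹' I)
    rw [Subtype.image_preimage_coe, inter_eq_self_of_subset_right hI] at this
    rw [this, ← image_comp]
    have e : (Subtype.val ∘ φ) '' (Subtype.val ⁻¹' I) = f '' I := by
      ext y
      constructor
      · rintro ⟨x, hx, rfl⟩; exact ⟨x, hx, hfx x⟩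
      · rintro ⟨x, hx, rfl⟩; exact ⟨⟨x, hI hx⟩, hx, (hfx ⟨x, hI hx⟩).symm⟩
    rw [e]

theorem rk_eq_of_bijOn [M.RankFinite] [N.RankFinite] {f : α → β} (hf : BijOn f M.E N.E)
    (h : ∀ I ⊆ M.E, M.Indep I ↔ N.Indep (f '' I)) {X : Set α} (hX : X ⊆ M.E) :
    rk N (f '' X) = rk M X := by
  apply le_antisymm
  · obtain ⟨I, hIX, hI, -, hc⟩ := exists_indep_ncard N (f '' X)
    obtain ⟨J, hJ, rfl⟩ := subset_image_iff.1 hIX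
    rw [← hc, (hf.injOn.mono (hJ.trans hX)).ncard_image]
    exact ncard_le_rk M ((h J (hJ.trans hX)).2 hI) hJ
  · obtain ⟨I, hIX, hI, -, hc⟩ := exists_indep_ncard M X
    rw [← hc, ← (hf.injOn.mono (hIX.trans hX)).ncard_image]
    exact ncard_le_rk N ((h I (hIX.trans hX)).1 hI) (image_mono hIX)

theorem IsIso.dual (h : IsIso M N) : IsIso M✶ N✶ := by
  rcases M.E.eq_empty_or_nonempty with hE | hE
  · have hN : N.E = ∅ := by
      obtain ⟨φ, -⟩ := h
      have : IsEmpty N.E := φ.isEmpty_congr.1 (isEmpty_coe_sort.2 hE)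
      exact isEmpty_coe_sort.1 this
    have e1 : IsEmpty M✶.E := isEmpty_coe_sort.2 hE
    have e2 : IsEmpty N✶.E := isEmpty_coe_sort.2 hN
    refine ⟨Equiv.equivOfIsEmpty _ _, fun I => ?_⟩
    rw [Set.eq_empty_of_isEmpty I]
    simp only [image_empty, empty_indep]
  · obtain ⟨f, hf, hI⟩ := h.exists_bijOn hE
    have hN : N = M.map f hf.injOn := by
      refine ext_indep hf.image_eq.symm fun I hIE => ?_
      rw [← hf.image_eq] at hIE
      obtain ⟨J, hJ, rfl⟩ := subset_image_iff.1 hIE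
      rw [← hI J hJ, map_image_indep_iff hJ]
    rw [hN, map_dual]
    refine isIso_of_bijOn f ?_ fun I hI => (map_image_indep_iff hI).symm
    exact hf.injOn.bijOn_image

theorem InMinorTogether.congr {e f : γ} (h : InMinorTogether M L e f) (hMN : IsIso M N) :
    InMinorTogether N L e f := by
  obtain ⟨L', h1, h2, h3⟩ := h
  exact ⟨L', h1, h2.trans hMN, h3⟩

theorem InMinorTogether.symm {e f : γ} (h : InMinorTogether M L e f) :
    InMinorTogether M L f e := by
  obtain ⟨L', h1, h2, h3, h4⟩ := h
  exact ⟨L', h1, h2, h4, h3⟩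

theorem InMinorTogether.dual {e f : γ} (h : InMinorTogether M L e f) :
    InMinorTogether M✶ L✶ e f := by
  obtain ⟨L', ⟨C, D, rfl⟩, h2, h3⟩ := h
  refine ⟨(L ／ C ＼ D)✶, ?_, h2.dual, h3⟩
  rw [dual_contract_delete, delete_contract_comm']
  exact contract_delete_isMinor _ _ _

theorem HasTransitivityProperty.congr (h : HasTransitivityProperty.{u, w} M) (hMN : IsIso M N) :
    HasTransitivityProperty.{v, w} N := by
  intro γ L hL e f g he hf hg h1 h2 h3 h4 h5
  exact (h γ L hL e f g he hf hg h1 h2 h3 (h4.congr hMN.symm) (h5.congr hMN.symm)).congr hMN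

theorem HasTransitivityProperty.dual (h : HasTransitivityProperty.{u, w} M) :
    HasTransitivityProperty.{u, w} M✶ := by
  intro γ L hL e f g he hf hg h1 h2 h3 h4 h5
  have h4' := h4.dual
  have h5' := h5.dual
  rw [dual_dual] at h4' h5'
  have := (h γ L✶ ⟨hL.ground_finite⟩ e f g he hf hg h1 h2 h3 h4' h5').dual
  rwa [dual_dual] at this

/-- A finite matroid is isomorphic to a matroid whose ground set is a whole finite type, in any
prescribed universe. -/
theorem exists_isIso_univ (M : Matroid α) [M.Finite] :
    ∃ (δ : Type w) (_ : Finite δ) (L : Matroid δ), L.E = univ ∧ IsIso M L := by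
  have : Finite M.E := M.ground_finite
  obtain ⟨n, ⟨e⟩⟩ := Finite.exists_equiv_fin M.E
  let e' : M.E ≃ ULift.{w} (Fin n) := e.trans Equiv.ulift.symm
  refine ⟨ULift.{w} (Fin n), inferInstance, (M.restrictSubtype M.E).mapEquiv e', by simp, ?_⟩
  refine ⟨e'.trans ((Equiv.Set.univ _).symm.trans (Equiv.setCongr (by simp))), fun I => ?_⟩
  rw [mapEquiv_indep_iff, restrictSubtype_indep_iff]
  have : e'.symm '' (Subtype.val '' (⇑(e'.trans ((Equiv.Set.univ _).symm.trans
      (Equiv.setCongr (by simp : univ = ((M.restrictSubtype M.E).mapEquiv e').E)))) '' I)) = I := by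
    rw [← image_comp, ← image_comp]
    have : ∀ x : M.E, e'.symm (e' x) = x := e'.symm_apply_apply
    ext x
    constructor
    · rintro ⟨y, hy, hxy⟩
      have := (this y).symm.trans hxy
      exact this ▸ hy
    · intro hx
      exact ⟨x, hx, this x⟩
  rw [this]

end Iso

/-! ### Matroids induced by submodular functions. -/

section Submodular

variable {ι : Type u} [Finite ι]

/-- The matroid induced by a monotone submodular function `f`: a set is independent if none of its
subsets has more elements than its value under `f`. -/
noncomputable def ofSubmodular (f : Set ι → ℕ) (h0 : f ∅ = 0) (hmono : Monotone f)
    (hsub : ∀ X Y, f (X ∩ Y) + f (X ∪ Y) ≤ f X + f Y) : Matroid ι :=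
  (IndepMatroid.ofFinite (E := univ) (toFinite _) (fun I => ∀ J ⊆ I, J.ncard ≤ f J)
    (by
      intro J hJ
      rw [subset_empty_iff.1 hJ]
      simp)
    (fun I J hJ hIJ K hK => hJ K (hK.trans hIJ))
    (by
      intro I J hI hJ hIJ
      by_contra hcon
      push Not at hcon
      -- Each element of `J \ I` that cannot be added to `I` has a violating set `K` containing it,
      -- with `f K ≤ |K \ {e}|`. Submodularity merges these sets one at a time.
      have key : ∀ S : Set ι, S ⊆ J \ I → ∃ X ⊆ I, f (X ∪ S) ≤ X.ncard := by
        intro S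
        induction S, toFinite S using Set.Finite.induction_on with
        | empty => exact fun _ => ⟨∅, empty_subset _, by simp [h0]⟩
        | @insert e S _ _ ih =>
          intro hS
          obtain ⟨X, hXI, hX⟩ := ih ((subset_insert _ _).trans hS)
          have heJ := hS (mem_insert e S)
          obtain ⟨K, hK, hKf⟩ := hcon e heJ.1 heJ.2
          have heK : e ∈ K := by
            by_contra heK
            exact absurd (hI K ((subset_insert_iff_of_notMem heK).1 hK)) (by omega)
          have hc := ncard_sdiff_singleton_add_one heK (toFinite _)
          have hY : K \ {e} ⊆ I := by simpa [sdiff_subset_iff] using hK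
          refine ⟨X ∪ K \ {e}, union_subset hXI hY, ?_⟩
          have h1 := hsub (X ∪ S) K
          have h2 : f (X ∩ (K \ {e})) ≤ f ((X ∪ S) ∩ K) :=
            hmono (inter_subset_inter subset_union_left sdiff_subset)
          have h3 := hI _ ((inter_subset_left (s := X) (t := K \ {e})).trans hXI)
          have h4 := ncard_union_add_ncard_inter X (K \ {e}) (toFinite _) (toFinite _)
          have h5 : X ∪ K \ {e} ∪ insert e S = X ∪ S ∪ K := by
            ext x
            by_cases hx : x = e
            · subst hx; simp [heK]
            · simp [hx]; tauto
          rw [h5]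
          omega
      obtain ⟨X, hXI, hX⟩ := key _ Subset.rfl
      -- Independence of `J` on this subset gives |J ∩ X| + |J \ I| ≤ f (X ∪ J \ I) ≤ |X|. Hence |J
      -- \ I| ≤ |X \ J| ≤ |I \ J|, contrary to |I| < |J|.
      have h1 := hJ (J ∩ X ∪ J \ I) (union_subset inter_subset_left sdiff_subset)
      have h2 : f (J ∩ X ∪ J \ I) ≤ f (X ∪ J \ I) :=
        hmono (union_subset_union_left _ inter_subset_right)
      have h3 : (J ∩ X ∪ J \ I).ncard = (J ∩ X).ncard + (J \ I).ncard := by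
        apply ncard_union_eq _ (toFinite _) (toFinite _)
        exact disjoint_left.2 fun x hx hx' => hx'.2 (hXI hx.2)
      have h4 := ncard_inter_add_ncard_sdiff_eq_ncard X J (toFinite _)
      have h5 := ncard_inter_add_ncard_sdiff_eq_ncard I J (toFinite _)
      have h6 := ncard_inter_add_ncard_sdiff_eq_ncard J I (toFinite _)
      have h7 : (X \ J).ncard ≤ (I \ J).ncard :=
        ncard_le_ncard (sdiff_subset_sdiff_left hXI) (toFinite _)
      rw [inter_comm] at h4 h5
      omega)
    (fun _ _ => subset_univ _)).matroid

variable {f : Set ι → ℕ} {h0 : f ∅ = 0} {hmono : Monotone f}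
    {hsub : ∀ X Y, f (X ∩ Y) + f (X ∪ Y) ≤ f X + f Y}

@[simp] theorem ofSubmodular_ground : (ofSubmodular f h0 hmono hsub).E = univ := rfl

theorem ofSubmodular_indep_iff {I : Set ι} :
    (ofSubmodular f h0 hmono hsub).Indep I ↔ ∀ J ⊆ I, J.ncard ≤ f J := Iff.rfl

instance : (ofSubmodular f h0 hmono hsub).Finite := ⟨toFinite _⟩

/-- If `f` measures sets containing `p` by the rank of their image in `N`, then `N` is obtained
from the matroid induced by `f` by contracting `p` and restricting. -/
theorem isIso_contract_ofSubmodular {γ : Type v} [Finite γ] {N : Matroid γ} (hN : N.E = univ)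
    {p : ι} {S : Set ι} (hpS : p ∉ S) (κ : ι → γ) (hκ : BijOn κ S univ)
    (hf : ∀ J ⊆ S, f (insert p J) = rk N (κ '' J) + 1) :
    ∃ D, ((ofSubmodular f h0 hmono hsub) ／ {p} ＼ D).E = S ∧
      IsIso ((ofSubmodular f h0 hmono hsub) ／ {p} ＼ D) N := by
  have : N.Finite := ⟨toFinite _⟩
  set M := ofSubmodular f h0 hmono hsub with hM
  have hp : M.IsNonloop p := by
    rw [← indep_singleton, ofSubmodular_indep_iff]
    intro J hJ
    rcases subset_singleton_iff_eq.1 hJ with rfl | rfl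
    · simp
    · have := hf ∅ (empty_subset _)
      simp at this
      simp [this]
  have hE : (M ／ {p} ＼ (insert p S)ᶜ).E = S := by
    ext x
    simp only [delete_ground, contract_ground, hM, ofSubmodular_ground, mem_sdiff, mem_univ,
      true_and, mem_singleton_iff, mem_compl_iff, mem_insert_iff, not_not]
    constructor
    · rintro ⟨h1, h2⟩; tauto
    · intro hx; exact ⟨fun h => hpS (h ▸ hx), Or.inr hx⟩
  refine ⟨(insert p S)ᶜ, hE, ?_⟩
  refine isIso_of_bijOn κ (by rw [hE, hN]; exact hκ) fun I hI => ?_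
  rw [hE] at hI
  have hpI : p ∉ I := fun h => hpS (hI h)
  rw [delete_indep_iff, hp.contractElem_indep_iff,
    and_iff_left (disjoint_compl_right_iff_subset.2 (hI.trans (subset_insert _ _))),
    and_iff_right hpI, ofSubmodular_indep_iff]
  have hcard : ∀ J ⊆ S, (κ '' J).ncard = J.ncard := fun J hJ => (hκ.injOn.mono hJ).ncard_image
  constructor
  · intro h
    rw [indep_iff_rk N (toFinite _)]
    apply le_antisymm (rk_le_ncard N (toFinite _))
    have := h _ Subset.rfl
    rw [hf I hI, ncard_insert_of_notMem hpI (toFinite _)] at this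
    rw [hcard I hI]
    omega
  · intro h J hJ
    have hJ' : J \ {p} ⊆ I := by simpa [sdiff_subset_iff] using hJ
    have h1 := (indep_iff_rk N (toFinite _)).1 (h.subset (image_mono hJ'))
    have h2 := hf _ (hJ'.trans hI)
    rw [h1, hcard _ (hJ'.trans hI), insert_sdiff_singleton] at h2
    by_cases hpJ : p ∈ J
    · rw [insert_eq_of_mem hpJ] at h2
      rw [h2, ncard_sdiff_singleton_add_one hpJ (toFinite _)]
    · rw [sdiff_singleton_eq_self hpJ] at h2
      -- Removing `p` costs at most `f {p}`, which is 1 by `hf` at the empty set.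
      have h3 := hsub {p} J
      have h4 := hf ∅ (empty_subset _)
      rw [singleton_union] at h3
      simp at h4
      omega

end Submodular

section Submodular

variable {ι : Type u} [Finite ι] {f : Set ι → ℕ} {h0 : f ∅ = 0} {hmono : Monotone f}
    {hsub : ∀ X Y, f (X ∩ Y) + f (X ∪ Y) ≤ f X + f Y}

theorem rk_ofSubmodular_le (X : Set ι) : rk (ofSubmodular f h0 hmono hsub) X ≤ f X := by
  obtain ⟨I, hIX, hI, -, hc⟩ := exists_indep_ncard (ofSubmodular f h0 hmono hsub) X
  rw [← hc]
  exact (ofSubmodular_indep_iff.1 hI I Subset.rfl).trans (hmono hIX)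

theorem rk_ofSubmodular_eq_ncard {I : Set ι} (h : ∀ J ⊆ I, J.ncard ≤ f J) :
    rk (ofSubmodular f h0 hmono hsub) I = I.ncard :=
  (indep_iff_rk _ (toFinite _)).1 (ofSubmodular_indep_iff.2 h)

theorem rk_ofSubmodular_singleton {x : ι} (hx : 1 ≤ f {x}) :
    rk (ofSubmodular f h0 hmono hsub) {x} = 1 := by
  rw [rk_ofSubmodular_eq_ncard, ncard_singleton]
  intro J hJ
  rcases subset_singleton_iff_eq.1 hJ with rfl | rfl
  · simp
  · simpa using hx

theorem rk_ofSubmodular_pair {x y : ι} (hxy : x ≠ y) (hx : 1 ≤ f {x}) (hy : 1 ≤ f {y})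
    (h : 2 ≤ f {x, y}) : rk (ofSubmodular f h0 hmono hsub) {x, y} = 2 := by
  rw [rk_ofSubmodular_eq_ncard, ncard_pair hxy]
  intro J hJ
  rcases subset_pair_iff_eq.1 hJ with rfl | rfl | rfl | rfl
  · simp
  · simpa using hx
  · simpa using hy
  · rwa [ncard_pair hxy]

end Submodular

theorem IsIso.exists_bijOn_rk {α : Type u} {β : Type v} {M : Matroid α} {N : Matroid β}
    [M.Finite] [N.Finite] (h : IsIso M N) (hne : M.E.Nonempty) :
    ∃ f : α → β, BijOn f M.E N.E ∧ ∀ X ⊆ M.E, rk N (f '' X) = rk M X := by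
  obtain ⟨f, hf, h⟩ := h.exists_bijOn hne
  exact ⟨f, hf, fun X hX => rk_eq_of_bijOn hf h hX⟩

/-- In the test matroids on `Option γ`, `none` is a second copy of `x`; dropping either copy leaves
a transversal of the folding map. -/
theorem bijOn_getD {γ : Type v} (x : γ) (S : Set (Option γ))
    (hS : S = {none}ᶜ ∨ S = {some x}ᶜ) : BijOn (fun o => o.getD x) S univ := by
  refine ⟨fun _ _ => mem_univ _, ?_, ?_⟩
  · rintro (_ | a) ha (_ | b) hb hab
    · rfl
    · rcases hS with rfl | rfl
      · simp at ha
      · simp at hab hb; exact absurd hab.symm hb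
    · rcases hS with rfl | rfl
      · simp at hb
      · simp at hab ha; exact absurd hab ha
    · simpa using hab
  · rintro y -
    rcases hS with rfl | rfl
    · exact ⟨some y, by simp, rfl⟩
    · by_cases hy : y = x
      · exact ⟨none, by simp, by simp [hy]⟩
      · exact ⟨some y, by simpa using hy, rfl⟩

theorem finite_of_finite_type {γ : Type v} [Finite γ] (N : Matroid γ) : N.Finite := ⟨toFinite _⟩

attribute [local instance] finite_of_finite_type

/-! ### Loops and parallel copies in a matroid with the transitivity property. -/

section Transitive

variable {γ : Type v} [Finite γ] {N : Matroid γ}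

/-- For a loop `l`, the function `f` adds one to the rank of every set meeting a nonloop or a copy
of `l`. The two copies become parallel nonloops, and contracting either of them recovers `N`. An
`N`-minor that keeps both copies has too few loops. -/
theorem HasTransitivityProperty.rk_singleton (ht : HasTransitivityProperty.{v, v} N)
    (hN : N.E = univ) [Nontrivial γ] (l : γ) : rk N {l} = 1 := by
  classical
  by_contra hl
  have hl0 : rk N {l} = 0 := by have := rk_singleton_le N l; omega
  obtain ⟨m, hm⟩ := exists_ne l
  let c : Option γ → γ := fun o => o.getD l
  obtain ⟨hit, hit_iff⟩ : ∃ hit : Set (Option γ) → Prop,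
      ∀ J, hit J ↔ ∃ o ∈ J, rk N {c o} = 1 ∨ c o = l := ⟨_, fun _ => Iff.rfl⟩
  let f : Set (Option γ) → ℕ := fun J => rk N (c '' J) + if hit J then 1 else 0
  have hitmono : ∀ {J K}, J ⊆ K → hit J → hit K := fun hJK h => by
    obtain ⟨o, ho, h⟩ := (hit_iff _).1 h
    exact (hit_iff _).2 ⟨o, hJK ho, h⟩
  have h0 : f ∅ = 0 := by simp [f, hit_iff]
  have hmono : Monotone f := by
    intro J K hJK
    refine Nat.add_le_add (rk_mono N (image_mono hJK)) ?_
    have := @hitmono J K hJK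
    grind
  have hsub : ∀ X Y, f (X ∩ Y) + f (X ∪ Y) ≤ f X + f Y := by
    intro X Y
    have h1 := rk_submod_of_subset N (image_inter_subset c X Y) (image_union c X Y).le
    have h2 : hit (X ∪ Y) → hit X ∨ hit Y := by
      simp only [hit_iff]
      rintro ⟨o, ho | ho, h⟩
      · exact Or.inl ⟨o, ho, h⟩
      · exact Or.inr ⟨o, ho, h⟩
    have h3 : hit (X ∩ Y) → hit X := hitmono inter_subset_left
    have h4 : hit (X ∩ Y) → hit Y := hitmono inter_subset_right
    simp only [f]
    grind
  have hinsl : ∀ A : Set γ, rk N (insert l A) = rk N A := by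
    intro A
    have h1 := rk_union_le N {l} A
    have h2 := rk_mono N (subset_insert l A)
    rw [singleton_union] at h1
    omega
  have hfins : ∀ (p : Option γ), c p = l → ∀ J, f (insert p J) = rk N (c '' J) + 1 := by
    intro p hp J
    have : hit (insert p J) := (hit_iff _).2 ⟨p, mem_insert _ _, Or.inr hp⟩
    simp only [f, this, if_true, image_insert_eq, hp, hinsl]
  obtain ⟨D1, hE1, hI1⟩ := isIso_contract_ofSubmodular (h0 := h0) (hmono := hmono) (hsub := hsub)
    hN (p := none) (S := {none}ᶜ) (by simp) c (bijOn_getD l _ (Or.inl rfl))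
    (fun J _ => hfins none rfl J)
  obtain ⟨D2, hE2, hI2⟩ := isIso_contract_ofSubmodular (h0 := h0) (hmono := hmono) (hsub := hsub)
    hN (p := some l) (S := {some l}ᶜ) (by simp) c (bijOn_getD l _ (Or.inr rfl))
    (fun J _ => hfins (some l) rfl J)
  set M := ofSubmodular f h0 hmono hsub with hM
  obtain ⟨M', hM', hiso, hlM', hnM'⟩ := ht (Option γ) M inferInstance (some l) (some m) none
    (mem_univ _) (mem_univ _) (mem_univ _) (by simpa using hm.symm) (by simp) (by simp)
    ⟨_, contract_delete_isMinor _ _ _, hI1, by rw [hE1]; simp, by rw [hE1]; simp⟩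
    ⟨_, contract_delete_isMinor _ _ _, hI2, by rw [hE2]; simpa using hm, by rw [hE2]; simp⟩
  obtain ⟨φ, hφ, hφr⟩ := hiso.exists_bijOn_rk ⟨_, hlM'⟩
  obtain ⟨C, D, -, -, -, rfl⟩ := hM'.exists_eq_contract_delete_disjoint
  set M' := M ／ C ＼ D with hM'def
  have hcard : M'.Eᶜ.ncard = 1 := by
    have h1 := ncard_add_ncard_compl M'.E
    have h2 := hφ.injOn.ncard_image
    rw [hφ.image_eq, hN, ncard_univ] at h2
    rw [Finite.card_option] at h1
    omega
  obtain ⟨z, hz⟩ := ncard_eq_one.1 hcard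
  have hzl : z ≠ some l := fun h => by
    have : z ∈ M'.Eᶜ := by rw [hz]; rfl
    exact this (h ▸ hlM')
  have hzn : z ≠ none := fun h => by
    have : z ∈ M'.Eᶜ := by rw [hz]; rfl
    exact this (h ▸ hnM')
  have hC : C ⊆ {z} := by
    rw [← hz]
    intro x hx hx'
    exact hx'.1.2 hx
  have hcz : c z ≠ l := by
    rcases z with _ | z
    · exact absurd rfl hzn
    · exact fun h => hzl (congrArg some h)
  have hf1 : ∀ x, f {x} = 0 ∨ 1 ≤ f {x} := fun x => by omega
  -- No loop is created in passing to `M'`: if the contracted `z` is a nonloop of `M`, then `c z` is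
  -- a nonloop of `N`, so `f {x, z} ≥ 2` and `x` is not parallel to `z`.
  have hM0 : ∀ x ∈ M'.E, rk M' {x} = 0 → f {x} = 0 := by
    intro x hxE hx
    have hr := rk_minor M (C := C) (D := D) (singleton_subset_iff.2 hxE)
    rw [← hM'def, hx] at hr
    rcases hf1 x with h | h
    · exact h
    exfalso
    have h1 : rk M {x} = 1 := rk_ofSubmodular_singleton h
    have h1' := rk_mono M (subset_union_left (s := {x}) (t := C))
    rcases subset_singleton_iff_eq.1 hC with rfl | rfl
    · rw [rk_empty] at hr; omega
    have h2 := rk_ofSubmodular_le (h0 := h0) (hmono := hmono) (hsub := hsub) {z}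
    have h3 : hit {z} := by
      by_contra hh
      have h4 : rk N {c z} ≠ 1 := fun h => hh ((hit_iff _).2 ⟨z, rfl, Or.inl h⟩)
      have h5 := rk_singleton_le N (c z)
      have : f {z} = 0 := by
        simp only [f, hh, if_false, image_singleton]; omega
      rw [← hM, this] at h2
      omega
    have h4 : rk N {c z} = 1 := by
      obtain ⟨o, rfl, h | h⟩ := (hit_iff _).1 h3
      · exact h
      · exact absurd h hcz
    have hxz : x ≠ z := fun h => by
      have : z ∈ M'.Eᶜ := by rw [hz]; rfl
      exact this (h ▸ hxE)
    have h5 : 2 ≤ f {x, z} := by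
      have : hit {x, z} := hitmono (by simp) h3
      have h6 : rk N {c z} ≤ rk N (c '' {x, z}) := rk_mono N (by simp [image_pair])
      simp only [f, this, if_true]
      omega
    have h6 : 1 ≤ f {z} := by simp only [f, h3, if_true]; omega
    have h7 : rk M {x, z} = 2 := rk_ofSubmodular_pair hxz h h6 h5
    have h8 := rk_singleton_le M z
    rw [singleton_union] at hr
    omega
  -- The loops of `N` are covered by an image of the loops other than `l`, which is impossible by
  -- counting.
  have hsubset : {u | rk N {u} = 0} ⊆ (φ ∘ some) '' ({u | rk N {u} = 0} \ {l}) := by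
    intro u hu
    obtain ⟨x, hx, rfl⟩ := hφ.surjOn (show u ∈ N.E by rw [hN]; trivial)
    have h1 := hφr {x} (singleton_subset_iff.2 hx)
    rw [image_singleton, hu] at h1
    have h2 := hM0 x hx h1.symm
    have h3 : ¬ hit {x} := fun h => by simp [f, h] at h2
    have h4 : rk N {c x} = 0 := by
      have : rk N {c x} ≠ 1 := fun h => h3 ((hit_iff _).2 ⟨x, rfl, Or.inl h⟩)
      have := rk_singleton_le N (c x)
      omega
    have h5 : c x ≠ l := fun h => h3 ((hit_iff _).2 ⟨x, rfl, Or.inr h⟩)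
    rcases x with _ | x
    · exact absurd rfl h5
    · exact ⟨x, ⟨h4, h5⟩, rfl⟩
  have h1 := ncard_le_ncard hsubset (toFinite _)
  have h2 := ncard_image_le (f := φ ∘ some) (toFinite ({u | rk N {u} = 0} \ {l}))
  have h3 := ncard_sdiff_singleton_add_one (show l ∈ {u | rk N {u} = 0} from hl0) (toFinite _)
  omega

/-- If `N` has the transitivity property, then a parallel element can be added at `x` and some
other element deleted to obtain `N` again. This is expressed by a self-map of the ground set. -/
theorem HasTransitivityProperty.exists_fold (ht : HasTransitivityProperty.{v, v} N)
    (hN : N.E = univ) [Nontrivial γ] (x : γ) :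
    ∃ (g : γ → γ) (z u₁ u₂ : γ), u₁ ≠ u₂ ∧ g u₁ = x ∧ g u₂ = x ∧ z ≠ x ∧ (∀ a, g a ≠ z) ∧
      InjOn g {u₁}ᶜ ∧ ∀ A, rk N (g '' A) = rk N A := by
  obtain ⟨m, hm⟩ := exists_ne x
  let c : Option γ → γ := fun o => o.getD x
  set M := N.comap c with hM
  have hME : M.E = univ := by simp [hM, hN]
  have hdel : ∀ p : Option γ, ({p}ᶜ = ({none}ᶜ : Set (Option γ)) ∨ {p}ᶜ = ({some x}ᶜ : Set _)) →
      (M ／ ∅ ＼ {p}).E = {p}ᶜ ∧ IsIso (M ／ ∅ ＼ {p}) N := by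
    intro p hp
    have hE : (M ／ ∅ ＼ {p}).E = {p}ᶜ := by simp [hME, compl_eq_univ_sdiff]
    refine ⟨hE, isIso_of_bijOn_rk c ?_ fun X hX => ?_⟩
    · rw [hE, hN]; exact bijOn_getD x _ hp
    · rw [hE] at hX
      rw [contract_empty, rk_delete, hM, rk_comap, sdiff_singleton_eq_self]
      exact fun h => hX h rfl
  obtain ⟨hE1, hI1⟩ := hdel none (Or.inl rfl)
  obtain ⟨hE2, hI2⟩ := hdel (some x) (Or.inr rfl)
  obtain ⟨M', hM', hiso, hxM', hnM'⟩ := ht (Option γ) M inferInstance (some x) (some m) none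
    (by simp [hME]) (by simp [hME]) (by simp [hME]) (by simpa using hm.symm) (by simp) (by simp)
    ⟨_, contract_delete_isMinor _ _ _, hI1, by rw [hE1]; simp, by rw [hE1]; simp⟩
    ⟨_, contract_delete_isMinor _ _ _, hI2, by rw [hE2]; simpa using hm, by rw [hE2]; simp⟩
  obtain ⟨C, D, -, -, -, rfl⟩ := hM'.exists_eq_contract_delete_disjoint
  set M' := M ／ C ＼ D with hM'def
  obtain ⟨h, hh, hhr⟩ := hiso.symm.exists_bijOn_rk (by rw [hN]; exact univ_nonempty)
  rw [hN] at hh hhr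
  have hr : rk M' M'.E = rk N univ := by
    rw [← hhr univ Subset.rfl, hh.image_eq]
  -- The added copy does not raise the rank, so `M'` has the rank of `M` and only loops can be
  -- contracted. Thus ranks in `M'` are ranks in `M`.
  have hC : rk M C = 0 := by
    have h1 := rk_minor M (C := C) (D := D) (X := M'.E) Subset.rfl
    have h2 : rk M (M'.E ∪ C) ≤ rk N univ := by
      rw [hM, rk_comap]; exact rk_mono N (subset_univ _)
    rw [← hM'def] at h1
    omega
  have hM'r : ∀ X ⊆ M'.E, rk M' X = rk N (c '' X) := by
    intro X hX
    have h1 := rk_minor M (C := C) (D := D) hX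
    have h2 := rk_union_le M X C
    have h3 := rk_mono M (subset_union_left (s := X) (t := C))
    rw [← hM'def] at h1
    rw [← rk_comap, ← hM]
    omega
  obtain ⟨z, hz⟩ : ∃ z, z ∉ M'.E := by
    by_contra hcon
    push Not at hcon
    have h1 := hh.injOn.ncard_image
    rw [hh.image_eq, eq_univ_of_forall hcon, ncard_univ, ncard_univ, Finite.card_option] at h1
    omega
  obtain ⟨z, rfl⟩ : ∃ a, z = some a := by
    rcases z with _ | z
    · exact absurd hnM' hz
    · exact ⟨z, rfl⟩
  obtain ⟨u₁, -, hu₁⟩ := hh.surjOn hnM'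
  obtain ⟨u₂, -, hu₂⟩ := hh.surjOn hxM'
  have hzx : z ≠ x := by rintro rfl; exact hz hxM'
  -- `h` embeds `N` in its extension, and `c` folds the two copies of `x` together.
  refine ⟨c ∘ h, z, u₁, u₂, ?_, by simp [c, hu₁], by simp [c, hu₂], hzx, fun a ha => ?_,
    fun a ha b hb hab => ?_, fun A => ?_⟩
  · rintro rfl
    rw [hu₁] at hu₂
    simp at hu₂
  · have haM := hh.mapsTo (mem_univ a)
    simp only [c, Function.comp] at ha
    rcases hha : h a with _ | b
    · rw [hha] at ha; exact hzx ha.symm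
    · rw [hha] at ha haM
      exact hz (ha ▸ haM)
  · have key : ∀ a ∈ ({u₁}ᶜ : Set γ), h a ∈ ({none}ᶜ : Set (Option γ)) := by
      intro a ha hn
      exact ha (hh.injOn (mem_univ _) (mem_univ _) (hn.trans hu₁.symm))
    exact hh.injOn (mem_univ _) (mem_univ _)
      ((bijOn_getD x _ (Or.inl rfl)).injOn (key a ha) (key b hb) hab)
  · rw [image_comp, ← hM'r _ ((image_mono (subset_univ A)).trans hh.image_eq.subset),
      hhr A (subset_univ _)]

end Transitive

/-! ### Two pencils of lines: at most one nontrivial parallel class. -/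

section Pencil

variable {γ : Type v} {N : Matroid γ}

open Classical in
/-- The rank function of the matroid obtained from `N` by adding two points, so that these two
points and `y` form a circuit of size three. -/
noncomputable def triangleRank (N : Matroid γ) (y : γ) (A : Set (γ ⊕ Bool)) : ℕ :=
  if Sum.inr true ∈ A ∧ Sum.inr false ∈ A then rk N (insert y (Sum.inl ⁻¹' A)) + 1
  else rk N (Sum.inl ⁻¹' A) + if Sum.inr true ∈ A ∨ Sum.inr false ∈ A then 1 else 0

open Classical in
/-- The two points of the triangle support themselves; any other element is supported on the line
through an element of `N` and one of the two points. -/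
noncomputable def pencilSupport (y : γ) (j : γ × Bool) : Set (γ ⊕ Bool) :=
  if j.1 = y then {Sum.inr j.2} else {Sum.inl j.1, Sum.inr (!j.2)}

/-- The submodular function inducing the matroid in which every element is placed freely on its
support. -/
noncomputable def pencilFun (N : Matroid γ) (y : γ) (J : Set (γ × Bool)) : ℕ :=
  triangleRank N y (⋃ j ∈ J, pencilSupport y j)

theorem pencilFun_empty (N : Matroid γ) (y : γ) : pencilFun N y ∅ = 0 := by
  simp [pencilFun, triangleRank]

theorem inl_mem_support {y u : γ} {J : Set (γ × Bool)} :
    Sum.inl u ∈ (⋃ j ∈ J, pencilSupport y j) ↔ u ≠ y ∧ ∃ b, (u, b) ∈ J := by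
  simp only [mem_iUnion, pencilSupport, Prod.exists, exists_prop]
  constructor
  · rintro ⟨a, b, hab, h⟩
    split_ifs at h with hay
    · simp at h
    · simp at h; subst h; exact ⟨hay, b, hab⟩
  · rintro ⟨hu, b, hb⟩
    exact ⟨u, b, hb, by simp [hu]⟩

theorem inr_mem_support {y : γ} {b : Bool} {J : Set (γ × Bool)} :
    Sum.inr b ∈ (⋃ j ∈ J, pencilSupport y j) ↔ (y, b) ∈ J ∨ ∃ u, u ≠ y ∧ (u, !b) ∈ J := by
  simp only [mem_iUnion, pencilSupport, Prod.exists, exists_prop]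
  constructor
  · rintro ⟨a, c, hac, h⟩
    split_ifs at h with hay
    · simp at h; subst h; subst hay; exact Or.inl hac
    · simp at h; subst h; exact Or.inr ⟨a, hay, by simpa using hac⟩
  · rintro (h | ⟨u, hu, h⟩)
    · exact ⟨y, b, h, by simp⟩
    · exact ⟨u, !b, h, by simp [hu]⟩

/-- Here `Sum.inr b` is known to lie in the support; the presence of the other triangle point
decides whether `y` joins the span. -/
theorem pencilFun_eq (N : Matroid γ) (y : γ) (J : Set (γ × Bool)) {X : Set γ}
    (hX : ∀ u, u ∈ X ↔ u ≠ y ∧ ∃ b, (u, b) ∈ J) {b : Bool}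
    (hb : (y, b) ∈ J ∨ ∃ u, u ≠ y ∧ (u, !b) ∈ J) :
    (((y, !b) ∈ J ∨ ∃ u, u ≠ y ∧ (u, b) ∈ J) → pencilFun N y J = rk N (insert y X) + 1) ∧
    (¬ ((y, !b) ∈ J ∨ ∃ u, u ≠ y ∧ (u, b) ∈ J) → pencilFun N y J = rk N X + 1) := by
  have hX' : Sum.inl ⁻¹' (⋃ j ∈ J, pencilSupport y j) = X := by
    ext u
    rw [mem_preimage, inl_mem_support, hX]
  have h1 : Sum.inr b ∈ (⋃ j ∈ J, pencilSupport y j) := inr_mem_support.2 hb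
  have h2 : Sum.inr (!b) ∈ (⋃ j ∈ J, pencilSupport y j) ↔
      ((y, !b) ∈ J ∨ ∃ u, u ≠ y ∧ (u, b) ∈ J) := by
    rw [inr_mem_support, Bool.not_not]
  rw [pencilFun, triangleRank, hX', ← h2]
  cases b <;> simp_all

/-- Contracting the centre `(y, false)` projects the lines through it onto their elements of `N`,
and the other centre onto `y`. -/
theorem pencilFun_insert_false (N : Matroid γ) (y : γ) {J : Set (γ × Bool)}
    (hJ : J ⊆ {j | j.2 = true}) :
    pencilFun N y (insert (y, false) J) = rk N (Prod.fst '' J) + 1 := by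
  have h := pencilFun_eq N y (insert (y, false) J) (X := Prod.fst '' J \ {y})
    (by
      intro u
      simp only [mem_sdiff, mem_image, Prod.exists, exists_and_right, exists_eq_right,
        mem_singleton_iff, mem_insert_iff, Prod.mk.injEq]
      constructor
      · rintro ⟨⟨b, hb⟩, hu⟩; exact ⟨hu, b, Or.inr hb⟩
      · rintro ⟨hu, b, hb⟩; exact ⟨⟨b, by tauto⟩, hu⟩) (b := false) (Or.inl (mem_insert _ _))
  by_cases hy : (y, true) ∈ J
  · rw [h.1 (Or.inl (Or.inr hy)), insert_sdiff_singleton, insert_eq_of_mem]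
    exact ⟨_, hy, rfl⟩
  · have hy' : y ∉ Prod.fst '' J := by
      rintro ⟨⟨a, b⟩, h1, rfl⟩
      have : b = true := hJ h1
      subst this
      exact hy h1
    rw [h.2, sdiff_singleton_eq_self hy']
    rintro (h1 | ⟨u, hu, h1⟩)
    · simp only [mem_insert_iff, Prod.mk.injEq] at h1
      rcases h1 with h1 | h1
      · simp at h1
      · exact hy h1
    · simp only [mem_insert_iff, Prod.mk.injEq] at h1
      rcases h1 with h1 | h1
      · exact hu h1.1
      · exact absurd (hJ h1) (by simp)

variable [Finite γ]

theorem triangleRank_mono (N : Matroid γ) (y : γ) : Monotone (triangleRank N y) := by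
  intro A B hAB
  have h1 : rk N (Sum.inl ⁻¹' A) ≤ rk N (Sum.inl ⁻¹' B) := rk_mono N (preimage_mono hAB)
  have h2 := rk_mono N (insert_subset_insert (a := y) (preimage_mono (f := Sum.inl) hAB))
  have h3 := rk_mono N (subset_insert y (Sum.inl ⁻¹' B))
  have h4 := rk_insert_le N y (Sum.inl ⁻¹' A)
  have h5 : Sum.inr true ∈ A → Sum.inr true ∈ B := fun h => hAB h
  have h6 : Sum.inr false ∈ A → Sum.inr false ∈ B := fun h => hAB h
  unfold triangleRank
  grind

theorem triangleRank_submod (N : Matroid γ) (y : γ) (A B : Set (γ ⊕ Bool)) :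
    triangleRank N y (A ∩ B) + triangleRank N y (A ∪ B) ≤
      triangleRank N y A + triangleRank N y B := by
  simp only [triangleRank, preimage_inter, preimage_union, mem_inter_iff, mem_union]
  generalize (Sum.inl ⁻¹' A : Set γ) = X
  generalize (Sum.inl ⁻¹' B : Set γ) = Y
  have h1 := rk_submod N X Y
  have h2 := rk_submod_of_subset N (X := insert y X) (Y := Y) (A := X ∩ Y) (B := insert y (X ∪ Y))
    (inter_subset_inter_left _ (subset_insert _ _)) (by rw [insert_union])
  have h3 := rk_submod_of_subset N (X := X) (Y := insert y Y) (A := X ∩ Y) (B := insert y (X ∪ Y))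
    (inter_subset_inter_right _ (subset_insert _ _)) (by rw [union_insert])
  have h4 := rk_submod_of_subset N (X := insert y X) (Y := insert y Y) (A := insert y (X ∩ Y))
    (B := insert y (X ∪ Y)) (by rw [insert_inter_distrib])
    (by rw [insert_union, union_insert]; simp)
  have h5 := rk_insert_le N y (X ∪ Y)
  grind

theorem pencilFun_mono (N : Matroid γ) (y : γ) : Monotone (pencilFun N y) :=
  fun _ _ h => triangleRank_mono N y (biUnion_subset_biUnion_left h)

theorem pencilFun_submod (N : Matroid γ) (y : γ) (J K : Set (γ × Bool)) :
    pencilFun N y (J ∩ K) + pencilFun N y (J ∪ K) ≤ pencilFun N y J + pencilFun N y K := by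
  refine le_trans (Nat.add_le_add (triangleRank_mono N y ?_) (le_of_eq ?_))
    (triangleRank_submod N y _ _)
  · exact subset_inter (biUnion_subset_biUnion_left inter_subset_left)
      (biUnion_subset_biUnion_left inter_subset_right)
  · rw [pencilFun, biUnion_union]

/-- The matroid of two pencils of lines whose centres are `(y, false)` and `(y, true)`. -/
noncomputable def pencil (N : Matroid γ) (y : γ) : Matroid (γ × Bool) :=
  ofSubmodular (pencilFun N y) (pencilFun_empty N y) (pencilFun_mono N y) (pencilFun_submod N y)

theorem two_le_pencilFun (hN : ∀ u, rk N {u} = 1) {y : γ} {J : Set (γ × Bool)} {j : γ × Bool}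
    (hj : j ∈ J) (hjy : j.1 ≠ y) : 2 ≤ pencilFun N y J := by
  refine le_trans ?_ (pencilFun_mono N y (singleton_subset_iff.2 hj))
  have hX : ∀ u, u ∈ ({j.1} : Set γ) ↔ u ≠ y ∧ ∃ b, (u, b) ∈ ({j} : Set (γ × Bool)) := by
    intro u
    simp only [mem_singleton_iff, Prod.ext_iff]
    constructor
    · rintro rfl; exact ⟨hjy, j.2, rfl, rfl⟩
    · rintro ⟨-, b, h, -⟩; exact h
  have h := pencilFun_eq N y {j} hX (b := !j.2) (Or.inr ⟨j.1, hjy, by simp⟩)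
  have h1 := hN j.1
  have h2 := rk_mono N (subset_insert y {j.1})
  by_cases hc : ((y, !!j.2) ∈ ({j} : Set (γ × Bool)) ∨ ∃ u, u ≠ y ∧ (u, !j.2) ∈ ({j} : Set _))
  · rw [h.1 hc]; omega
  · rw [h.2 hc]; omega

theorem one_le_pencilFun (hN : ∀ u, rk N {u} = 1) (y : γ) (j : γ × Bool) :
    1 ≤ pencilFun N y {j} := by
  by_cases hj : j.1 = y
  · obtain ⟨a, b⟩ := j
    subst hj
    have h := pencilFun_eq N a {(a, b)} (X := ∅) (by simp) (b := b) (Or.inl rfl)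
    by_cases hc : ((a, !b) ∈ ({(a, b)} : Set (γ × Bool)) ∨
        ∃ u, u ≠ a ∧ (u, b) ∈ ({(a, b)} : Set _))
    · rw [h.1 hc]; omega
    · rw [h.2 hc]; omega
  · exact (two_le_pencilFun hN (mem_singleton j) hj).trans' (by norm_num)

theorem two_le_pencilFun_pair (hN : ∀ u, rk N {u} = 1) (y : γ) {i j : γ × Bool} (hij : i ≠ j) :
    2 ≤ pencilFun N y {i, j} := by
  by_cases hi : i.1 = y
  · by_cases hj : j.1 = y
    · obtain ⟨a, b⟩ := i
      obtain ⟨c, d⟩ := j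
      dsimp at hi hj
      subst hi; subst hj
      have hd : d = !b := by
        cases b <;> cases d <;> simp_all
      subst hd
      have h := (pencilFun_eq N c {(c, b), (c, !b)} (X := ∅) (by simp; tauto) (b := b)
        (Or.inl (by simp))).1 (Or.inl (by simp))
      have := hN c
      rw [h, insert_empty_eq]
      omega
    · exact two_le_pencilFun hN (by simp) hj
  · exact two_le_pencilFun hN (j := i) (by simp) hi

/-- The elements of the second pencil, together with the common element `(y', true)`. -/
def secondPencil (y' : γ) : Set (γ × Bool) := {j | j.2 = false ∧ j.1 ≠ y' ∨ j = (y', true)}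

/-- Contracting `(y, true)` turns `Sum.inr false` into a copy of `y`. The element `(y', true)` lies
on the line through that point and `y'`; as `y` and `y'` are parallel, it still represents `y'`. -/
theorem pencilFun_insert_true (N : Matroid γ) {y y' : γ} (hyy' : y ≠ y') (hy : rk N {y'} = 1)
    (hp : rk N {y, y'} = 1) {J : Set (γ × Bool)} (hJ : J ⊆ secondPencil y') :
    pencilFun N y (insert (y, true) J) = rk N (Prod.fst '' J) + 1 := by
  have h := pencilFun_eq N y (insert (y, true) J) (X := Prod.fst '' J \ {y})
    (by
      intro u
      simp only [mem_sdiff, mem_image, Prod.exists, exists_and_right, exists_eq_right,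
        mem_singleton_iff, mem_insert_iff, Prod.mk.injEq]
      constructor
      · rintro ⟨⟨b, hb⟩, hu⟩; exact ⟨hu, b, Or.inr hb⟩
      · rintro ⟨hu, b, hb⟩; exact ⟨⟨b, by tauto⟩, hu⟩) (b := true) (Or.inl (mem_insert _ _))
  by_cases hyJ : y ∈ Prod.fst '' J
  · rw [h.1, insert_sdiff_singleton, insert_eq_of_mem hyJ]
    obtain ⟨⟨a, b⟩, h1, rfl⟩ := hyJ
    rcases hJ h1 with h2 | h2
    · left; right; simpa [h2.1.symm] using h1
    · exact absurd (congrArg Prod.fst h2) hyy'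
  · rw [sdiff_singleton_eq_self hyJ] at h
    by_cases hy'J : y' ∈ Prod.fst '' J
    · rw [h.1]
      · have h1 := rk_submod_of_subset N (X := {y, y'}) (Y := Prod.fst '' J) (A := {y'})
          (B := insert y (Prod.fst '' J)) (by simpa using hy'J) (by
            rw [insert_union]
            exact insert_subset_insert subset_union_right)
        have h2 := rk_mono N (subset_insert y (Prod.fst '' J))
        omega
      · obtain ⟨⟨a, b⟩, h1, rfl⟩ := hy'J
        right
        refine ⟨a, hyy'.symm, Or.inr ?_⟩
        rcases hJ h1 with h2 | h2
        · exact absurd rfl h2.2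
        · rwa [h2] at h1
    · rw [h.2]
      rintro (h1 | ⟨u, hu, h1⟩)
      · rcases h1 with h1 | h1
        · simp at h1
        · exact hyJ ⟨_, h1, rfl⟩
      · rcases h1 with h1 | h1
        · exact hu (congrArg Prod.fst h1)
        · rcases hJ h1 with h2 | h2
          · simp at h2
          · exact hy'J ⟨_, h1, congrArg Prod.fst h2⟩

/-- A matroid with the transitivity property has at most one nontrivial parallel class. -/
theorem HasTransitivityProperty.rk_of_parallel (ht : HasTransitivityProperty.{v, v} N)
    (hN : N.E = univ) {y y' w w' : γ} (hyy' : y ≠ y') (hww' : w ≠ w') (hy : rk N {y, y'} = 1)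
    (hw : rk N {w, w'} = 1) : rk N {y, w} ≤ 1 := by
  by_contra hyw
  have : Nontrivial γ := ⟨y, y', hyy'⟩
  have hl := ht.rk_singleton hN
  have hS1 : BijOn Prod.fst {j : γ × Bool | j.2 = true} univ := by
    refine ⟨fun _ _ => mem_univ _, ?_, fun u _ => ⟨(u, true), rfl, rfl⟩⟩
    rintro ⟨a, b⟩ h1 ⟨c, d⟩ h2 h
    simp at h1 h2 h
    simp [h1, h2, h]
  have hS2 : BijOn Prod.fst (secondPencil y') univ := by
    refine ⟨fun _ _ => mem_univ _, ?_, fun u _ => ?_⟩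
    · rintro ⟨a, b⟩ h1 ⟨c, d⟩ h2 h
      simp [secondPencil] at h1 h2 h
      ext
      · exact h
      · subst h; grind
    · by_cases hu : u = y'
      · exact ⟨(y', true), Or.inr rfl, hu.symm⟩
      · exact ⟨(u, false), Or.inl ⟨rfl, hu⟩, rfl⟩
  obtain ⟨D1, hE1, hI1⟩ := isIso_contract_ofSubmodular (h0 := pencilFun_empty N y)
    (hmono := pencilFun_mono N y) (hsub := pencilFun_submod N y) hN (p := (y, false))
    (by simp) Prod.fst hS1 (fun J hJ => pencilFun_insert_false N y hJ)
  obtain ⟨D2, hE2, hI2⟩ := isIso_contract_ofSubmodular (h0 := pencilFun_empty N y)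
    (hmono := pencilFun_mono N y) (hsub := pencilFun_submod N y) hN (p := (y, true))
    (by simp [secondPencil, hyy']) Prod.fst hS2
    (fun J hJ => pencilFun_insert_true N hyy' (hl y') hy hJ)
  change (pencil N y ／ {(y, false)} ＼ D1).E = _ at hE1
  change (pencil N y ／ {(y, true)} ＼ D2).E = _ at hE2
  -- Both pencils contain `(y', true)`, so transitivity puts the two centres in one `N`-minor.
  obtain ⟨M', hM', hiso, htM', hfM'⟩ := ht (γ × Bool) (pencil N y) inferInstance (y, true)
    (y', true) (y, false) (mem_univ _) (mem_univ _) (mem_univ _) (by simpa using hyy')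
    (by simp) (by simp)
    ⟨_, contract_delete_isMinor _ _ _, hI1, by rw [hE1]; simp, by rw [hE1]; simp⟩
    ⟨_, contract_delete_isMinor _ _ _, hI2, by rw [hE2]; simp [secondPencil],
      by rw [hE2]; simp [secondPencil, hyy']⟩
  obtain ⟨C, D, -, -, -, rfl⟩ := hM'.exists_eq_contract_delete_disjoint
  set M := pencil N y with hM
  obtain ⟨h, hh, hhr⟩ := hiso.symm.exists_bijOn_rk (by rw [hN]; exact univ_nonempty)
  rw [hN] at hh hhr
  have hmin : ∀ A, rk N A + rk M C = rk M (h '' A ∪ C) := by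
    intro A
    rw [← hhr A (subset_univ A)]
    exact rk_minor M ((image_mono (subset_univ A)).trans hh.image_eq.subset)
  have hinj : ∀ {a b}, a ≠ b → h a ≠ h b := fun hab e =>
    hab (hh.injOn (mem_univ _) (mem_univ _) e)
  -- The rank of the pencil matroid exceeds that of `N` by at most one.
  have hC : rk M C ≤ 1 := by
    have h1 := hmin univ
    have h2 : rk M (h '' univ ∪ C) ≤ pencilFun N y univ :=
      (rk_ofSubmodular_le _).trans (pencilFun_mono N y (subset_univ _))
    have h3 := (pencilFun_eq N y univ (X := {y}ᶜ) (by simp) (b := true) (by simp)).1 (by simp)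
    have h4 := rk_mono N (subset_univ (insert y {y}ᶜ))
    omega
  rcases Nat.lt_or_ge 0 (rk M C) with hC0 | hC0
  · obtain ⟨I, hIC, hI, -, hIc⟩ := exists_indep_ncard M C
    obtain ⟨z, rfl⟩ := ncard_eq_one.1 (show I.ncard = 1 by omega)
    have hzC : z ∈ C := hIC rfl
    have hzE : z ∉ range h := by
      rintro ⟨a, rfl⟩
      exact (hh.mapsTo (mem_univ a)).1.2 hzC
    have hz1 : rk M {z} = 1 := (indep_iff_rk M (toFinite _)).1 hI |>.trans (ncard_singleton z)
    have hzy : z.1 ≠ y := by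
      obtain ⟨a, b⟩ := z
      rintro rfl
      cases b
      · exact hfM'.1.2 hzC
      · exact htM'.1.2 hzC
    -- Parallel elements of `N` form a dependent triple with `z`. Singletons and pairs violate no
    -- bound, so the triple itself does.
    have hline : ∀ {a b}, a ≠ b → rk N {a, b} = 1 → pencilFun N y {z, h a, h b} ≤ 2 := by
      intro a b hab hr
      by_contra hcon
      have hcard : ({z, h a, h b} : Set (γ × Bool)).ncard = 3 :=
        ncard_eq_three.2 ⟨z, h a, h b, fun e => hzE ⟨a, e.symm⟩, fun e => hzE ⟨b, e.symm⟩,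
          hinj hab, rfl⟩
      have hind : rk M {z, h a, h b} = 3 := by
        rw [← hcard]
        refine rk_ofSubmodular_eq_ncard fun J hJ => ?_
        have hJ3 := ncard_le_ncard hJ (toFinite _)
        rcases Nat.lt_or_ge J.ncard 3 with hlt | hge
        · interval_cases hc : J.ncard
          · omega
          · obtain ⟨j, rfl⟩ := ncard_eq_one.1 hc
            exact one_le_pencilFun hl y j
          · obtain ⟨i, j, hij, rfl⟩ := ncard_eq_two.1 hc
            exact two_le_pencilFun_pair hl y hij
        · have : J = {z, h a, h b} := eq_of_subset_of_ncard_le hJ (by omega) (toFinite _)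
          rw [this, hcard]
          omega
      have h1 := hmin {a, b}
      have h2 : rk M {z, h a, h b} ≤ rk M (h '' {a, b} ∪ C) := by
        apply rk_mono
        rw [image_pair]
        rintro x (rfl | hx)
        · exact Or.inr hzC
        · exact Or.inl hx
      omega
    have h1 := hline hyy' hy
    have h2 := hline hww' hw
    -- `z` is not a centre, so its support alone has value at least 2. Two sets of value at most 2
    -- sharing `z` thus have a union of value at most 2, which makes `y` and `w` parallel.
    have h3 := pencilFun_submod N y {z, h y, h y'} {z, h w, h w'}
    have h4 : 2 ≤ pencilFun N y ({z, h y, h y'} ∩ {z, h w, h w'}) :=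
      two_le_pencilFun hl (j := z) (by simp) hzy
    have h5 : rk M ({z} ∪ h '' {y, w}) ≤ pencilFun N y ({z, h y, h y'} ∪ {z, h w, h w'}) := by
      refine (rk_ofSubmodular_le _).trans (pencilFun_mono N y ?_)
      rw [image_pair]
      rintro x (rfl | rfl | rfl) <;> simp
    have h6 := hmin {y, w}
    have h7 := rk_submod_of_subset M (X := C) (Y := {z} ∪ h '' {y, w}) (A := {z})
      (B := h '' {y, w} ∪ C) (by simpa using hzC)
      (by rintro x (hx | hx); exacts [Or.inr (Or.inr hx), Or.inl hx])
    omega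
  -- With nothing of positive rank contracted, `y` and `y'` would stay parallel in a matroid whose
  -- pairs all have rank two.
  · have h1 := hmin {y, y'}
    have h2 : rk M {h y, h y'} = 2 := rk_ofSubmodular_pair (hinj hyy') (one_le_pencilFun hl y _)
      (one_le_pencilFun hl y _) (two_le_pencilFun_pair hl y (hinj hyy'))
    have h3 := rk_mono M (subset_union_left (s := h '' {y, y'}) (t := C))
    rw [image_pair] at h1 h3
    omega

end Pencil

/-! ### Recognizing the two small matroids by ranks. -/

section Small

theorem uniformMatroid_ground (r n : ℕ) : (uniformMatroid r n).E = univ := rfl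

theorem uniformMatroid_indep_iff {r n : ℕ} {I : Set (Fin n)} :
    (uniformMatroid r n).Indep I ↔ I.ncard ≤ r := by
  obtain ⟨J, rfl⟩ := (toFinite I).exists_finset_coe
  rw [ncard_coe_finset]
  change (∀ K : Finset (Fin n), (K : Set (Fin n)) ⊆ J → K.card ≤ r) ↔ _
  exact ⟨fun h => h J Subset.rfl, fun h K hK => (Finset.card_le_card (by simpa using hK)).trans h⟩

theorem wheelMatroidTwo_ground : wheelMatroidTwo.E = univ := rfl

theorem wheelMatroidTwo_indep_iff {I : Set (Fin 2 ⊕ Fin 2)} :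
    wheelMatroidTwo.Indep I ↔ I.ncard ≤ 2 ∧ ¬ (Sum.inr 0 ∈ I ∧ Sum.inr 1 ∈ I) := by
  obtain ⟨J, rfl⟩ := (toFinite I).exists_finset_coe
  rw [ncard_coe_finset]
  exact isForestEdgeSet_wheel_two J

variable {α : Type u} {M : Matroid α}

theorem isIso_uniformMatroid_one_two {q k : α} (hE : M.E = {q, k}) (hqk : q ≠ k)
    (hq : rk M {q} = 1) (hk : rk M {k} = 1) (hr : rk M {q, k} = 1) :
    IsIso M (uniformMatroid 1 2) := by
  have : M.Finite := ⟨by rw [hE]; exact toFinite _⟩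
  have hf : BijOn ![q, k] (uniformMatroid 1 2).E M.E := by
    rw [uniformMatroid_ground, hE]
    refine ⟨fun i _ => by fin_cases i <;> simp, fun i _ j _ h => ?_, ?_⟩
    · fin_cases i <;> fin_cases j <;> simp_all
    · rintro x (rfl | rfl)
      exacts [⟨0, trivial, rfl⟩, ⟨1, trivial, rfl⟩]
  refine (isIso_of_bijOn _ hf fun I _ => ?_).symm
  rw [uniformMatroid_indep_iff, indep_iff_rk M (toFinite _),
    (hf.injOn.mono (subset_univ I)).ncard_image]
  constructor
  · intro h
    rcases Nat.lt_or_ge I.ncard 1 with h0 | h0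
    · obtain rfl : I = ∅ := (ncard_eq_zero (toFinite _)).1 (by omega)
      simp
    · obtain ⟨i, rfl⟩ := ncard_eq_one.1 (le_antisymm h h0)
      rw [image_singleton, ncard_singleton]
      fin_cases i
      exacts [hq, hk]
  · intro h
    rw [← h, ← hr, ← hE, ← hf.image_eq]
    exact rk_mono M (image_mono (subset_univ I))

theorem isIso_wheelMatroidTwo {p p' q k : α} (hE : M.E = {p, p', q, k}) (hp : rk M {p, p'} ≤ 1)
    (hpp' : p ≠ p') (hpq : rk M {p, q} = 2) (hpk : rk M {p, k} = 2) (hpq' : rk M {p', q} = 2)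
    (hpk' : rk M {p', k} = 2) (hqk : rk M {q, k} = 2) (hr : rk M M.E ≤ 2) :
    IsIso M wheelMatroidTwo := by
  have : M.Finite := ⟨by rw [hE]; exact toFinite _⟩
  have hne : ∀ {a b}, rk M {a, b} = 2 → a ≠ b := by
    rintro a _ h rfl
    have := rk_singleton_le M a
    rw [pair_eq_singleton] at h
    omega
  have hl : ∀ {a b}, rk M {a, b} = 2 → rk M {a} = 1 ∧ rk M {b} = 1 := by
    intro a b h
    have h1 := rk_singleton_le M a
    have h2 := rk_singleton_le M b
    have h3 := rk_union_le M {a} {b}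
    rw [singleton_union] at h3
    omega
  let f : Fin 2 ⊕ Fin 2 → α := Sum.elim ![q, k] ![p, p']
  have hf : BijOn f wheelMatroidTwo.E M.E := by
    rw [wheelMatroidTwo_ground, hE]
    refine ⟨fun i _ => ?_, fun i _ j _ h => ?_, ?_⟩
    · rcases i with i | i <;> fin_cases i <;> simp [f]
    · have h1 := hne hpq
      have h2 := hne hpk
      have h3 := hne hpq'
      have h4 := hne hpk'
      have h5 := hne hqk
      clear hE hp hpq hpk hpq' hpk' hqk hr hne hl
      rcases i with i | i <;> rcases j with j | j <;> fin_cases i <;> fin_cases j <;>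
        simp [f] at h ⊢ <;> tauto
    · rintro x (rfl | rfl | rfl | rfl)
      exacts [⟨Sum.inr 0, trivial, rfl⟩, ⟨Sum.inr 1, trivial, rfl⟩, ⟨Sum.inl 0, trivial, rfl⟩,
        ⟨Sum.inl 1, trivial, rfl⟩]
  refine (isIso_of_bijOn f hf fun I _ => ?_).symm
  rw [wheelMatroidTwo_indep_iff, indep_iff_rk M (toFinite _),
    (hf.injOn.mono (subset_univ I)).ncard_image]
  constructor
  · rintro ⟨h, h'⟩
    rcases Nat.lt_or_ge I.ncard 1 with h0 | h0
    · obtain rfl : I = ∅ := (ncard_eq_zero (toFinite _)).1 (by omega)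
      simp
    rcases Nat.lt_or_ge I.ncard 2 with h1 | h1
    · obtain ⟨i, rfl⟩ := ncard_eq_one.1 (show I.ncard = 1 by omega)
      rw [image_singleton, ncard_singleton]
      rcases i with i | i <;> fin_cases i
      exacts [(hl hpq).2, (hl hpk).2, (hl hpq).1, (hl hpq').1]
    · obtain ⟨i, j, hij, rfl⟩ := ncard_eq_two.1 (le_antisymm h h1)
      rw [image_pair, ncard_pair hij]
      rcases i with i | i <;> rcases j with j | j <;> fin_cases i <;> fin_cases j <;>
        simp_all [f, pair_comm]
  · intro h
    constructor
    · rw [← h]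
      exact (rk_mono M (hf.image_eq ▸ image_mono (subset_univ I))).trans hr
    · rintro ⟨h0, h1⟩
      have hI : M.Indep (f '' I) := by
        rw [indep_iff_rk M (toFinite _), h, (hf.injOn.mono (subset_univ I)).ncard_image]
      have h2 : ({p, p'} : Set α) ⊆ f '' I := by
        rintro x (rfl | rfl)
        exacts [⟨_, h0, rfl⟩, ⟨_, h1, rfl⟩]
      have h3 := (indep_iff_rk M (toFinite _)).1 (hI.subset h2)
      rw [ncard_pair hpp'] at h3
      omega

end Small

/-! ### Existence and uniqueness of the parallel pair, and the resulting automorphisms. -/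

section Endgame

variable {γ : Type v} [Finite γ] {N : Matroid γ}

theorem one_le_rk_of_mem (hl : ∀ a, rk N {a} = 1) {a : γ} {X : Set γ} (ha : a ∈ X) :
    1 ≤ rk N X := by
  rw [← hl a]
  exact rk_mono N (singleton_subset_iff.2 ha)

theorem HasTransitivityProperty.exists_parallel (ht : HasTransitivityProperty.{v, v} N)
    (hN : N.E = univ) [Nontrivial γ] : ∃ p p', p ≠ p' ∧ rk N {p, p'} = 1 := by
  obtain ⟨g, z, u₁, u₂, hu, h1, h2, -, -, -, hg⟩ := ht.exists_fold hN (Classical.arbitrary γ)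
  refine ⟨u₁, u₂, hu, ?_⟩
  rw [← hg, image_pair, h1, h2, pair_eq_singleton]
  exact ht.rk_singleton hN _

/-- If `x` is parallel to no other element, then there is exactly one parallel pair `{p, p'}`, and
`N ＼ {p}` has an automorphism that sends `p'` to `x`. -/
theorem HasTransitivityProperty.exists_bijOn_compl (ht : HasTransitivityProperty.{v, v} N)
    (hN : N.E = univ) {p p' x : γ} (hpp' : p ≠ p') (hp : rk N {p, p'} = 1)
    (hx : ∀ y, y ≠ x → rk N {x, y} ≠ 1) :
    (∀ w w', w ≠ w' → rk N {w, w'} = 1 → w = p ∨ w = p') ∧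
    ∃ g : γ → γ, g p' = x ∧ BijOn g {p}ᶜ {p}ᶜ ∧ ∀ A, rk N (g '' A) = rk N A := by
  classical
  have : Nontrivial γ := ⟨p, p', hpp'⟩
  have hl := ht.rk_singleton hN
  obtain ⟨g, z, u₁, u₂, hu, h1, h2, hzx, hz, hinj, hg⟩ := ht.exists_fold hN x
  have hu1 : rk N {u₁, u₂} = 1 := by
    rw [← hg, image_pair, h1, h2, pair_eq_singleton]
    exact hl x
  -- Any other `w` with a parallel partner would be parallel to `u₁`. Then `g w` would be parallel
  -- to `x` but different from it, since `g` is injective off `u₁`.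
  have huniq : ∀ w w', w ≠ w' → rk N {w, w'} = 1 → w = u₁ ∨ w = u₂ := by
    intro w w' hw hw1
    by_contra! hcon
    have h3 := ht.rk_of_parallel hN hu hw hu1 hw1
    rw [← hg, image_pair, h1] at h3
    have h4 : g w ≠ x := fun h => hcon.2 (hinj hcon.1 hu.symm (h.trans h2.symm))
    exact hx _ h4 (le_antisymm h3 (one_le_rk_of_mem hl (mem_insert _ _)))
  have huniq' : ∀ w w', w ≠ w' → rk N {w, w'} = 1 → w = u₁ ∧ w' = u₂ ∨ w = u₂ ∧ w' = u₁ := by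
    intro w w' hw hw1
    have h3 := huniq w w' hw hw1
    have h4 := huniq w' w hw.symm (by rwa [pair_comm])
    grind
  have himg : g '' {u₁}ᶜ = {z}ᶜ := by
    refine eq_of_subset_of_ncard_le ?_ ?_ (toFinite _)
    · rintro _ ⟨a, -, rfl⟩
      exact hz a
    · rw [hinj.ncard_image, ncard_compl, ncard_compl, ncard_singleton, ncard_singleton]
  -- If `g` hit both `u₁` and `u₂`, their preimages would be a parallel pair, hence `u₁` and `u₂`
  -- again. These map to `x`, forcing `x = u₁` or `x = u₂`.
  have hzu : z = u₁ ∨ z = u₂ := by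
    by_contra! hcon
    obtain ⟨a, ha, ha'⟩ := himg.symm.subset (show u₁ ∈ ({z}ᶜ : Set γ) from hcon.1.symm)
    obtain ⟨b, hb, hb'⟩ := himg.symm.subset (show u₂ ∈ ({z}ᶜ : Set γ) from hcon.2.symm)
    have hab : a ≠ b := by rintro rfl; exact hu (ha'.symm.trans hb')
    have h3 := huniq' a b hab (by rw [← hg, image_pair, ha', hb']; exact hu1)
    have h4 : x ≠ u₁ := by
      rintro rfl
      exact hx _ hu.symm hu1
    rcases h3 with h3 | h3
    · exact h4 (by rw [← ha', h3.1, h1])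
    · exact h4 (by rw [← ha', h3.1, h2])
  have hpu := huniq' p p' hpp' hp
  refine ⟨fun w w' h h' => by grind, ?_⟩
  have hgp : g p = x ∧ g p' = x := by grind
  have hinj' : InjOn g {p}ᶜ := by
    intro a ha b hb hab
    have h3 : ∀ a, a ≠ p → g a = x → a = p' := fun a ha hax => by
      rcases hpu with ⟨rfl, rfl⟩ | ⟨rfl, rfl⟩
      · exact hinj ha hu.symm (hax.trans h2.symm)
      · by_contra h
        exact ha (hinj h hu.symm (hax.trans h2.symm))
    by_cases hax : g a = x
    · rw [h3 a ha hax, h3 b hb (hab ▸ hax)]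
    · refine hinj ?_ ?_ hab
      · rintro rfl; exact hax h1
      · rintro rfl; exact hax (hab.trans h1)
  have hx' : x ≠ p ∧ x ≠ p' := by
    constructor
    · rintro rfl; exact hx _ hpp'.symm hp
    · rintro rfl; exact hx _ hpp' (by rwa [pair_comm])
  -- Exchanging two parallel elements preserves rank; this is used to make `p` the element missed by
  -- the self-map.
  have hswap : ∀ A, rk N (Equiv.swap p p' '' A) = rk N A := by
    have key : ∀ A, rk N (A ∪ {p, p'}) = rk N A ∨ p ∉ A ∧ p' ∉ A := by
      intro A
      by_cases h : p ∈ A ∨ p' ∈ A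
      · left
        have h3 := rk_mono N (subset_union_left (s := A) (t := {p, p'}))
        have h4 := rk_submod N A {p, p'}
        have h5 : 1 ≤ rk N (A ∩ {p, p'}) := by
          rcases h with h | h
          · exact one_le_rk_of_mem hl (a := p) (by simp [h])
          · exact one_le_rk_of_mem hl (a := p') (by simp [h])
        omega
      · right; tauto
    intro A
    by_cases h : p ∉ A ∧ p' ∉ A
    · congr 1
      ext a
      rw [Equiv.image_eq_preimage_symm, mem_preimage, Equiv.symm_swap, Equiv.swap_apply_def]
      grind
    · rw [← (key A).resolve_right h, ← (key (Equiv.swap p p' '' A)).resolve_right]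
      · congr 1
        ext a
        rw [Equiv.image_eq_preimage_symm, mem_union, mem_preimage, Equiv.symm_swap,
          Equiv.swap_apply_def]
        grind
      · rintro ⟨h3, h4⟩
        apply h
        exact ⟨fun h => h4 ⟨p, h, by simp⟩, fun h => h3 ⟨p', h, by simp⟩⟩
  obtain ⟨g', hg'1, hg'2, hg'3, hg'4⟩ : ∃ g' : γ → γ, g' p' = x ∧ InjOn g' {p}ᶜ ∧
      (∀ a, g' a ≠ p) ∧ ∀ A, rk N (g' '' A) = rk N A := by
    by_cases hzp : z = p
    · exact ⟨g, hgp.2, hinj', fun a => hzp ▸ hz a, hg⟩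
    · have hzp' : z = p' := by grind
      refine ⟨Equiv.swap p p' ∘ g, ?_, (Equiv.injective _).comp_injOn hinj', ?_, ?_⟩
      · simp [hgp.2, Equiv.swap_apply_of_ne_of_ne hx'.1 hx'.2]
      · intro a h
        apply hz a
        rw [hzp']
        simpa using (congrArg (Equiv.swap p p') h)
      · intro A
        rw [image_comp, hswap, hg]
  refine ⟨g', hg'1, ?_, hg'4⟩
  refine ⟨fun a _ => hg'3 a, hg'2, ?_⟩
  have : g' '' {p}ᶜ = {p}ᶜ := by
    refine eq_of_subset_of_ncard_le ?_ ?_ (toFinite _)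
    · rintro _ ⟨a, -, rfl⟩
      exact hg'3 a
    · rw [hg'2.ncard_image]
  exact this.symm.subset

end Endgame

/-! ### Classification of matroids with the transitivity property. -/

section Classification

variable {γ : Type v} [Finite γ] {N : Matroid γ}

theorem rk_dual_add_rk_univ (hN : N.E = univ) (X : Set γ) :
    rk N✶ X + rk N univ = rk N Xᶜ + X.ncard := by
  have h := rk_dual N (X := X) (by rw [hN]; exact subset_univ X)
  rwa [hN, ← compl_eq_univ_sdiff] at h

theorem HasTransitivityProperty.rk_compl_singleton (ht : HasTransitivityProperty.{v, v} N)
    (hN : N.E = univ) [Nontrivial γ] (a : γ) : rk N {a}ᶜ = rk N univ := by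
  have h1 := ht.dual.rk_singleton hN a
  have h2 := rk_dual_add_rk_univ hN {a}
  rw [ncard_singleton] at h2
  omega

theorem rk_dual_pair (hN : N.E = univ) {a b : γ} (hab : a ≠ b) :
    rk N✶ {a, b} + rk N univ = rk N {a, b}ᶜ + 2 := by
  rw [rk_dual_add_rk_univ hN, ncard_pair hab]

/-- In rank one, the complement of a series pair has rank zero, hence is empty as there are no
loops. -/
theorem HasTransitivityProperty.eq_pair (ht : HasTransitivityProperty.{v, v} N)
    (hN : N.E = univ) [Nontrivial γ] (h : ∀ a b, rk N {a, b} ≤ 1) :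
    ∃ q k : γ, q ≠ k ∧ univ = ({q, k} : Set γ) ∧ rk N univ = 1 := by
  have hr : rk N univ ≤ 1 := by
    obtain ⟨I, -, hI, hfin, hc⟩ := exists_indep_ncard N univ
    by_contra hcon
    obtain ⟨a, ha, b, hb, hab⟩ := (one_lt_ncard hfin).1 (show 1 < I.ncard by omega)
    have h1 := (indep_iff_rk N (toFinite _)).1 (hI.subset (pair_subset ha hb))
    rw [ncard_pair hab] at h1
    have := h a b
    omega
  have hl := ht.rk_singleton hN
  obtain ⟨q, k, hqk, hq⟩ := ht.dual.exists_parallel hN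
  have h1 := rk_dual_pair hN hqk
  refine ⟨q, k, hqk, ?_, le_antisymm hr (one_le_rk_of_mem hl (mem_univ q))⟩
  symm
  by_contra hne
  obtain ⟨c, hc⟩ := (ne_univ_iff_exists_notMem _).1 hne
  have := one_le_rk_of_mem hl (show c ∈ ({q, k} : Set γ)ᶜ from hc)
  omega

/-- The argument for a matroid with the transitivity property that is neither a parallel class nor
a series class. -/
theorem HasTransitivityProperty.isIso_wheelMatroidTwo_of_ne
    (ht : HasTransitivityProperty.{v, v} N) (hN : N.E = univ) [Nontrivial γ] {x₀ y₀ : γ}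
    (hx₀ : ∀ y, y ≠ x₀ → rk N {x₀, y} ≠ 1) (hy₀ : ∀ y, y ≠ y₀ → rk N✶ {y₀, y} ≠ 1) :
    IsIso N wheelMatroidTwo := by
  have hl := ht.rk_singleton hN
  have hcl := ht.rk_compl_singleton hN
  obtain ⟨p, p', hpp', hp⟩ := ht.exists_parallel hN
  obtain ⟨q, k, hqk, hq⟩ := ht.dual.exists_parallel hN
  have hP := (ht.exists_bijOn_compl hN hpp' hp hx₀).1
  have hQ := (ht.dual.exists_bijOn_compl hN hqk hq hy₀).1
  have hfold : ∀ x, x ≠ p → x ≠ p' → ∃ g : γ → γ, g p' = x ∧ BijOn g {p}ᶜ {p}ᶜ ∧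
      ∀ A, rk N (g '' A) = rk N A := by
    intro x hx hx'
    refine (ht.exists_bijOn_compl hN hpp' hp fun y hy hxy => ?_).2
    rcases hP x y hy.symm hxy with h | h
    exacts [hx h, hx' h]
  obtain ⟨r, hr⟩ : ∃ r, r = rk N univ := ⟨_, rfl⟩
  -- `d A` is the rank of what remains of `N ＼ {p}` after deleting `A`. Since single deletions keep
  -- rank `r` (`hd1`), `d {a, b} < r` says that `a` and `b` are in series there.
  obtain ⟨d, hd⟩ : ∃ d : Set γ → ℕ, ∀ A, d A = rk N ({p}ᶜ \ A) := ⟨_, fun _ => rfl⟩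
  have hdsub : ∀ A B C D, A ∪ B = C → A ∩ B = D → d C + d D ≤ d A + d B := by
    rintro A B _ _ rfl rfl
    rw [hd, hd, hd, hd]
    exact rk_submod_of_subset N (by rw [sdiff_inter_sdiff]) (by rw [sdiff_inter])
  have hdmono : ∀ A B, A ⊆ B → d B ≤ d A := fun A B h => by
    rw [hd, hd]
    exact rk_mono N (sdiff_subset_sdiff_right h)
  have hdg : ∀ g : γ → γ, BijOn g {p}ᶜ {p}ᶜ → (∀ A, rk N (g '' A) = rk N A) →
      ∀ A ⊆ {p}ᶜ, d (g '' A) = d A := by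
    intro g hg hgr A hA
    rw [hd, hd, ← hgr ({p}ᶜ \ A), hg.injOn.image_sdiff_subset hA, hg.image_eq]
  have hadd : ∀ p p' A, rk N {p, p'} = 1 → p' ∈ A → rk N (insert p A) = rk N A := by
    intro p p' A h1 hA
    have h2 := rk_submod_of_subset N (X := {p, p'}) (Y := A) (A := {p'}) (B := insert p A)
      (by simpa using hA) (by
        rw [insert_union]
        exact insert_subset_insert subset_union_right)
    have h3 := hl p'
    have h4 := rk_mono N (subset_insert p A)
    omega
  have hdeq : ∀ A, p' ∉ A → p ∉ A → d A = rk N Aᶜ := by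
    intro A hA hpA
    rw [hd, ← hadd p p' ({p}ᶜ \ A) hp ⟨hpp'.symm, hA⟩]
    congr 1
    ext x
    by_cases h : x = p <;> simp [h, hpA]
  have hd1 : ∀ a, a ≠ p → d {a} = r := by
    have h1 : ∀ a, a ≠ p → a ≠ p' → d {a} = r := by
      intro a ha ha'
      rw [hdeq {a} (by simpa using ha'.symm) (by simpa using ha.symm), hcl, hr]
    intro a ha
    by_cases ha' : a = p'
    · subst ha'
      -- For `p'` itself, an automorphism of `N ＼ {p}` moves the question to `x₀`.
      have hx0 : x₀ ≠ p := by
        rintro rfl; exact hx₀ a hpp'.symm hp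
      have hx0' : x₀ ≠ a := by
        rintro rfl; exact hx₀ p hpp' (by rwa [pair_comm])
      obtain ⟨g, hg1, hg2, hg3⟩ := hfold x₀ hx0 hx0'
      rw [← hdg g hg2 hg3 {a} (by simpa using hpp'), image_singleton, hg1, h1 _ hx0 hx0']
    · exact h1 a ha ha'
  have hdr : ∀ A, d A ≤ r := fun A => by
    rw [hd, hr]
    exact rk_mono N (subset_univ _)
  -- A series pair of `N ＼ {p}` avoiding `p'` is one of `N`, because `p'` still spans `p`.
  have hser : ∀ a b, a ≠ b → a ≠ p → a ≠ p' → b ≠ p → b ≠ p' → d {a, b} < r →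
      a = q ∨ a = k := by
    intro a b hab h1 h2 h3 h4 h5
    rw [hdeq _ (by simp [h2.symm, h4.symm]) (by simp [h1.symm, h3.symm])] at h5
    refine hQ a b hab ?_
    have h6 := rk_dual_pair hN hab
    have h7 : 1 ≤ rk N✶ {a, b} := one_le_rk_of_mem (ht.dual.rk_singleton hN) (mem_insert a _)
    omega
  have hqk' : rk N {q, k}ᶜ + 1 = r := by
    have := rk_dual_pair hN hqk
    omega
  have hdisj : ∀ q k, q ≠ k → rk N {q, k}ᶜ + 1 = r → q ≠ p ∧ q ≠ p' := by
    intro q k h1 h2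
    have h3 : ∀ a, ({p, a} : Set γ)ᶜ = {p}ᶜ \ {a} := fun a => by
      ext x; simp [not_or]
    constructor
    · rintro rfl
      rw [h3, ← hd, hd1 k h1.symm] at h2
      omega
    · rintro rfl
      by_cases h5 : k = p
      · subst h5
        rw [pair_comm, h3, ← hd, hd1 q hpp'.symm] at h2
        omega
      · rw [← hadd q p _ (by rwa [pair_comm]) (by simp [hpp', Ne.symm h5])] at h2
        have h6 : insert q ({q, k} : Set γ)ᶜ = {k}ᶜ := by
          ext x
          by_cases h : x = q <;> simp [h, h1]
        rw [h6, hcl] at h2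
        omega
  obtain ⟨hqp, hqp'⟩ := hdisj q k hqk hqk'
  obtain ⟨hkp, hkp'⟩ := hdisj k q hqk.symm (by rwa [pair_comm])
  have hdins : ∀ a A, d A ≤ d (insert a A) + 1 := by
    intro a A
    rw [hd, hd]
    refine (rk_mono N ?_).trans (rk_insert_le N a _)
    rintro x ⟨hx, hx'⟩
    by_cases h : x = a
    · exact Or.inl h
    · exact Or.inr ⟨hx, fun h' => h'.elim h hx'⟩
  have hdqk : d {q, k} < r := by
    rw [hdeq _ (by simp [hqp'.symm, hkp'.symm]) (by simp [hqp.symm, hkp.symm])]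
    omega
  -- Pulling the series pair {q, k} back along an automorphism sending `p'` to `q` gives a series
  -- partner of `p'`.
  obtain ⟨t, htp, htp', hdt⟩ : ∃ t, t ≠ p ∧ t ≠ p' ∧ d {t, p'} < r := by
    obtain ⟨g, hg1, hg2, hg3⟩ := hfold q hqp hqp'
    obtain ⟨t, ht1, ht2⟩ := hg2.surjOn (show k ∈ ({p}ᶜ : Set γ) from hkp)
    refine ⟨t, ht1, ?_, ?_⟩
    · rintro rfl; exact hqk (hg1.symm.trans ht2)
    · rw [← hdg g hg2 hg3 _ (by rintro x (rfl | rfl); exacts [ht1, hpp'.symm]), image_pair, ht2,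
        hg1, pair_comm]
      exact hdqk
  -- Moving {t, p'} so that `p'` goes to `x` gives `x` a series partner, which must be `p'` as `x`
  -- is not in {q, k}.
  have hR : ∀ x, x ≠ p → x ≠ p' → x ≠ q → x ≠ k → d {x, p'} < r := by
    intro x h1 h2 h3 h4
    obtain ⟨g, hg1, hg2, hg3⟩ := hfold x h1 h2
    have h5 : d {x, g t} < r := by
      rw [← hdg g hg2 hg3 _ (by rintro x (rfl | rfl); exacts [htp, hpp'.symm]), image_pair, hg1,
        pair_comm] at hdt
      exact hdt
    have h6 : x ≠ g t := by
      intro h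
      exact htp' (hg2.injOn htp hpp'.symm (h.symm.trans hg1.symm))
    by_cases h7 : g t = p'
    · rwa [h7] at h5
    · rcases hser x (g t) h6 h1 h2 (hg2.mapsTo htp) h7 h5 with h | h
      exacts [absurd h h3, absurd h h4]
  -- Being in series is transitive through `p'`, which is not a coloop of `N ＼ {p}`.
  have hRR : ∀ x y, x ≠ y → x ≠ p → x ≠ p' → y ≠ p → y ≠ p' → d {x, p'} < r → d {y, p'} < r →
      x = q ∨ x = k := by
    intro x y hxy h1 h2 h3 h4 h5 h6
    refine hser x y hxy h1 h2 h3 h4 ?_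
    have h7 := hdsub {x, p'} {y, p'} {p', x, y} {p'} (by ext; simp; tauto) (by
      ext z
      simp only [mem_inter_iff, mem_insert_iff, mem_singleton_iff]
      grind)
    have h8 := hdins p' {x, y}
    have h9 := hd1 p' hpp'.symm
    omega
  have hpair : ∀ a b, a ≠ b → a ≠ p → a ≠ p' → rk N {a, b} = 2 := by
    intro a b hab h1 h2
    have h3 : rk N {a, b} ≠ 1 := fun h => by
      rcases hP a b hab h with h | h
      exacts [h1 h, h2 h]
    have h4 := one_le_rk_of_mem hl (mem_insert a {b})
    have h5 := rk_le_ncard N (toFinite {a, b})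
    rw [ncard_pair hab] at h5
    omega
  -- If `t` is `q` or `k`, then `q` is in series with `p'`. A fifth element would be too, and hence
  -- would be in series with `q`.
  by_cases htQ : t = q ∨ t = k
  · have hqR : ∀ q k, q ≠ k → q ≠ p → d {q, k} < r → d {q, p'} < r → k ≠ p' → d {k, p'} < r := by
      intro q k h1 h2 h3 h4 h5
      have h6 := hdsub {q, k} {q, p'} {q, k, p'} {q} (by ext; simp; tauto) (by
        ext z
        simp only [mem_inter_iff, mem_insert_iff, mem_singleton_iff]
        grind)
      have h7 := hdins q {k, p'}
      have h8 := hd1 q h2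
      omega
    have hqd : d {q, p'} < r := by
      rcases htQ with rfl | rfl
      · exact hdt
      · exact hqR t q hqk.symm htp (by rwa [pair_comm]) hdt hqp'
    have hE : (univ : Set γ) = {p, p', q, k} := by
      symm
      rw [eq_univ_iff_forall]
      intro x
      simp only [mem_insert_iff, mem_singleton_iff]
      by_contra! hx
      obtain ⟨h1, h2, h3, h4⟩ := hx
      rcases hRR x q h3 h1 h2 hqp hqp' (hR x h1 h2 h3 h4) hqd with h | h
      exacts [h3 h, h4 h]
    have hr2 : r ≤ 2 := by
      have h1 := hd1 p' hpp'.symm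
      have h2 : ({p}ᶜ \ {p'} : Set γ) ⊆ {q, k} := by
        rintro x ⟨hx, hx'⟩
        have : x ∈ ({p, p', q, k} : Set γ) := hE ▸ mem_univ x
        simp only [mem_compl_iff, mem_insert_iff, mem_singleton_iff] at hx hx' this ⊢
        tauto
      rw [hd] at h1
      have h3 := rk_mono N h2
      rw [hpair q k hqk hqp hqp'] at h3
      omega
    exact isIso_wheelMatroidTwo (p := p) (p' := p') (q := q) (k := k) (hN.trans hE) hp.le hpp'
      (by rw [pair_comm]; exact hpair q p hqp hqp hqp')
      (by rw [pair_comm]; exact hpair k p hkp hkp hkp')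
      (by rw [pair_comm]; exact hpair q p' hqp' hqp hqp')
      (by rw [pair_comm]; exact hpair k p' hkp' hkp hkp') (hpair q k hqk hqp hqp')
      (by rw [hN, ← hr]; exact hr2)
  -- Otherwise the elements are p, p', q, k, t. Then r > d {t, p'} ≥ rk {q, k} = 2, while d {q, p'}
  -- ≤ rk {k, t} ≤ 2. So `q` would also be in series with `p'`, hence with `t`.
  · exfalso
    push Not at htQ
    have hE : ∀ x, x = p ∨ x = p' ∨ x = q ∨ x = k ∨ x = t := by
      intro x
      by_contra! hx
      obtain ⟨h1, h2, h3, h4, h5⟩ := hx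
      rcases hRR x t h5 h1 h2 htp htp' (hR x h1 h2 h3 h4) hdt with h | h
      exacts [h3 h, h4 h]
    have h1 : ({q, k} : Set γ) ⊆ {p}ᶜ \ {t, p'} := by
      rintro x (rfl | rfl)
      · simp [hqp, hqp', htQ.1.symm]
      · simp [hkp, hkp', htQ.2.symm]
    have h2 : ({p}ᶜ \ {q, p'} : Set γ) ⊆ {k, t} := by
      rintro x ⟨hx, hx'⟩
      simp only [mem_compl_iff, mem_insert_iff, mem_singleton_iff] at hx hx' ⊢
      have := hE x
      tauto
    have h3 := rk_mono N h1
    have h4 := rk_mono N h2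
    rw [← hd, hpair q k hqk hqp hqp'] at h3
    rw [← hd] at h4
    have h5 := rk_le_ncard N (toFinite {k, t})
    rw [ncard_pair htQ.2.symm] at h5
    rcases hRR t q htQ.1 htp htp' hqp hqp' hdt (by omega) with h | h
    exacts [htQ.1 h, htQ.2 h]

/-- A matroid with the transitivity property is `U_{1,2}` or the wheel of rank two. -/
theorem HasTransitivityProperty.isIso (ht : HasTransitivityProperty.{v, v} N) (hN : N.E = univ)
    [Nontrivial γ] : IsIso N (uniformMatroid 1 2) ∨ IsIso N wheelMatroidTwo := by
  have hl := ht.rk_singleton hN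
  have hU : ∀ q k : γ, q ≠ k → univ = ({q, k} : Set γ) → rk N univ = 1 →
      IsIso N (uniformMatroid 1 2) := fun q k hqk h h1 =>
    isIso_uniformMatroid_one_two (hN.trans h) hqk (hl q) (hl k) (h ▸ h1)
  by_cases h1 : ∀ a b, rk N {a, b} ≤ 1
  · obtain ⟨q, k, hqk, h, hr⟩ := ht.eq_pair hN h1
    exact Or.inl (hU q k hqk h hr)
  by_cases h2 : ∀ a b, rk N✶ {a, b} ≤ 1
  · obtain ⟨q, k, hqk, h, hr⟩ := ht.dual.eq_pair hN h2
    have h3 := rk_dual_add_rk_univ hN univ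
    rw [compl_univ, rk_empty, hr, h, ncard_pair hqk, ← h] at h3
    exact Or.inl (hU q k hqk h (by omega))
  push Not at h1 h2
  obtain ⟨a, b, hab⟩ := h1
  obtain ⟨a', b', hab'⟩ := h2
  -- If every element had a parallel partner, uniqueness of the nontrivial class would give every
  -- pair rank at most one.
  have key : ∀ L : Matroid γ, HasTransitivityProperty.{v, v} L → L.E = univ →
      ∀ a b, 1 < rk L {a, b} → ∃ x, ∀ y, y ≠ x → rk L {x, y} ≠ 1 := by
    intro L hL hE a b h
    by_contra! hcon
    obtain ⟨a', ha', ha⟩ := hcon a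
    obtain ⟨b', hb', hb⟩ := hcon b
    have := hL.rk_of_parallel hE ha'.symm hb'.symm ha hb
    omega
  obtain ⟨x₀, hx₀⟩ := key N ht hN a b hab
  obtain ⟨y₀, hy₀⟩ := key N✶ ht.dual hN a' b' hab'
  exact Or.inr (ht.isIso_wheelMatroidTwo_of_ne hN hx₀ hy₀)

end Classification

/-! ### Connectivity, reduction to connected matroids, and `U_{1,2}`-minors. -/

section Connected

variable {α : Type u} {β : Type v} {M M' : Matroid β} {e g x : β}

theorem delete_isMinor (M : Matroid β) (D : Set β) : M ＼ D ≤m M := ⟨∅, D, by simp⟩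

theorem contract_isMinor (M : Matroid β) (C : Set β) : M ／ C ≤m M := ⟨C, ∅, by simp⟩

theorem restrict_isMinor (M : Matroid β) {A : Set β} (hA : A ⊆ M.E) : M ↾ A ≤m M := by
  refine ⟨∅, M.E \ A, ?_⟩
  rw [contract_empty, delete_eq_restrict, sdiff_sdiff_cancel_left hA]

/-- A matroid is connected if its ground set is not the union of two disjoint nonempty sets whose
ranks add up to the rank of the matroid. -/
def IsConnected (M : Matroid β) : Prop :=
  ∀ A ⊆ M.E, A.Nonempty → (M.E \ A).Nonempty → rk M M.E < rk M A + rk M (M.E \ A)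

theorem IsConnected.of_isIso {N : Matroid α} [M.Finite] [N.Finite] (h : IsConnected M)
    (hMN : IsIso M N) : IsConnected N := by
  intro A hA hne hne'
  have hneN : N.E.Nonempty := hne.mono hA
  obtain ⟨f, hf, hr⟩ := hMN.symm.exists_bijOn_rk hneN
  have h1 := h (f '' A) (hf.image_eq ▸ image_mono hA) (hne.image f)
    (by rw [← hf.image_eq, ← hf.injOn.image_sdiff_subset hA]; exact hne'.image f)
  rwa [← hf.image_eq, ← hf.injOn.image_sdiff_subset hA, hr _ hA, hr _ sdiff_subset,
    hr _ Subset.rfl] at h1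

theorem IsConnected.dual [M.Finite] (h : IsConnected M) : IsConnected M✶ := by
  intro A hA hne hne'
  rw [dual_ground] at *
  have h1 := h A hA hne hne'
  have h2 := rk_dual M hA
  have h3 := rk_dual M (X := M.E \ A) sdiff_subset
  have h4 := rk_dual M (X := M.E) Subset.rfl
  have h5 := ncard_sdiff_add_ncard_of_subset hA M.ground_finite
  rw [sdiff_sdiff_cancel_left hA] at h3
  rw [sdiff_self, rk_empty] at h4
  omega

theorem IsConnected.rk_singleton [M.Finite] (h : IsConnected M) (he : e ∈ M.E) (hg : g ∈ M.E)
    (heg : e ≠ g) : rk M {e} = 1 := by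
  have h1 := h {e} (singleton_subset_iff.2 he) (singleton_nonempty e) ⟨g, hg, heg.symm⟩
  have h2 := rk_mono M (sdiff_subset (s := M.E) (t := {e}))
  have h3 := rk_singleton_le M e
  omega

theorem IsConnected.rk_sdiff_singleton [M.Finite] (h : IsConnected M) (he : e ∈ M.E)
    (hg : g ∈ M.E) (heg : e ≠ g) : rk M (M.E \ {e}) = rk M M.E := by
  have h1 := h {e} (singleton_subset_iff.2 he) (singleton_nonempty e) ⟨g, hg, heg.symm⟩
  have h2 := rk_mono M (sdiff_subset (s := M.E) (t := {e}))
  have h3 := rk_singleton_le M e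
  omega

/-- Uncross a separation (A, B) of the deletion with a separation (C, D) of the contraction. If A ∩
C and B ∩ D were both nonempty, submodularity would make one of them separate `M`. The same holds
for A ∩ D and B ∩ C, so one of the four parts is empty. -/
theorem IsConnected.delete_or_contract [M.Finite] (h : IsConnected M) (x : β) :
    IsConnected (M ＼ {x}) ∨ IsConnected (M ／ {x}) := by
  by_cases hx : x ∈ M.E
  swap
  · left
    rwa [delete_eq_self]
    simpa using hx
  by_contra! hcon
  obtain ⟨h1, h2⟩ := hcon
  unfold IsConnected at h1 h2
  push Not at h1 h2
  obtain ⟨A, hA, hAne, hBne, hAB⟩ := h1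
  obtain ⟨C, hC, hCne, hDne, hCD⟩ := h2
  rw [delete_ground] at hA hBne hAB
  rw [contract_ground] at hC hDne hCD
  obtain ⟨B, hB⟩ : ∃ B, B = (M.E \ {x}) \ A := ⟨_, rfl⟩
  obtain ⟨D, hD⟩ : ∃ D, D = (M.E \ {x}) \ C := ⟨_, rfl⟩
  rw [← hB] at hBne hAB
  rw [← hD] at hDne hCD
  have hBE : B ⊆ M.E \ {x} := hB ▸ sdiff_subset
  have hDE : D ⊆ M.E \ {x} := hD ▸ sdiff_subset
  have hn : ∀ X ⊆ M.E \ {x}, X \ {x} = X := fun X hX =>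
    sdiff_singleton_eq_self fun h => (hX h).2 rfl
  rw [rk_delete, rk_delete, rk_delete, hn _ hA, hn _ hBE, hn _ Subset.rfl] at hAB
  have h3 := rk_mono M (sdiff_subset (s := M.E) (t := {x}))
  have h4 := rk_contract M {x} C
  have h5 := rk_contract M {x} D
  have h6 := rk_contract M {x} (M.E \ {x})
  rw [sdiff_union_of_subset (singleton_subset_iff.2 hx)] at h6
  have h7 := rk_singleton_le M x
  have hunc : ∀ A B C D, A ⊆ M.E \ {x} → C ⊆ M.E \ {x} → B = (M.E \ {x}) \ A →
      D = (M.E \ {x}) \ C → rk M A + rk M B ≤ rk M (M.E \ {x}) →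
      rk M (C ∪ {x}) + rk M (D ∪ {x}) ≤ rk M M.E + 1 → A ∩ C = ∅ ∨ B ∩ D = ∅ := by
    rintro A B C D hA hC rfl rfl h1 h2
    by_contra! hne
    obtain ⟨hAC, hBD⟩ := hne
    have k1 := rk_submod_of_subset M (X := A) (Y := C ∪ {x}) (A := A ∩ C) (B := A ∪ C ∪ {x})
      (inter_subset_inter_right _ subset_union_left) (union_assoc _ _ _).subset
    have k2 := rk_submod_of_subset M (X := (M.E \ {x}) \ A) (Y := (M.E \ {x}) \ C ∪ {x})
      (A := ((M.E \ {x}) \ A) ∩ ((M.E \ {x}) \ C))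
      (B := ((M.E \ {x}) \ A) ∪ ((M.E \ {x}) \ C) ∪ {x})
      (inter_subset_inter_right _ subset_union_left) (union_assoc _ _ _).subset
    have k3 := h (A ∩ C) (inter_subset_left.trans (hA.trans sdiff_subset)) hAC
      ⟨x, hx, fun h => (hA h.1).2 rfl⟩
    have k4 := h (((M.E \ {x}) \ A) ∩ ((M.E \ {x}) \ C))
      (inter_subset_left.trans (sdiff_subset.trans sdiff_subset)) hBD
      ⟨x, hx, fun h => h.1.1.2 rfl⟩
    have k5 : M.E \ (A ∩ C) ⊆ ((M.E \ {x}) \ A) ∪ ((M.E \ {x}) \ C) ∪ {x} := by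
      rintro y ⟨hy, hy'⟩
      by_cases hyx : y = x
      · exact Or.inr hyx
      · by_cases hyA : y ∈ A
        · exact Or.inl (Or.inr ⟨⟨hy, hyx⟩, fun hyC => hy' ⟨hyA, hyC⟩⟩)
        · exact Or.inl (Or.inl ⟨⟨hy, hyx⟩, hyA⟩)
    have k6 : M.E \ (((M.E \ {x}) \ A) ∩ ((M.E \ {x}) \ C)) ⊆ A ∪ C ∪ {x} := by
      rintro y ⟨hy, hy'⟩
      by_contra hcon
      simp only [mem_union, mem_singleton_iff, not_or] at hcon
      exact hy' ⟨⟨⟨hy, hcon.2⟩, hcon.1.1⟩, ⟨hy, hcon.2⟩, hcon.1.2⟩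
    have k7 := rk_mono M k5
    have k8 := rk_mono M k6
    omega
  have h8 := hunc A B C D hA hC hB hD hAB (by omega)
  have h9 := hunc A B D C hA hDE hB (by rw [hD, sdiff_sdiff_cancel_left hC]) hAB (by omega)
  obtain ⟨a, ha⟩ := hAne
  obtain ⟨b, hb⟩ := hBne
  obtain ⟨c, hc⟩ := hCne
  obtain ⟨d, hd⟩ := hDne
  simp only [eq_empty_iff_forall_notMem, mem_inter_iff, not_and] at h8 h9
  have m1 : ∀ y, y ∈ M.E \ {x} → y ∈ A ∨ y ∈ B := fun y hy => by
    rw [hB]; exact (em (y ∈ A)).imp_right fun h => ⟨hy, h⟩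
  have m2 : ∀ y, y ∈ M.E \ {x} → y ∈ C ∨ y ∈ D := fun y hy => by
    rw [hD]; exact (em (y ∈ C)).imp_right fun h => ⟨hy, h⟩
  have n1 := m2 a (hA ha)
  have n2 := m2 b (hBE hb)
  have n3 := m1 c (hC hc)
  have n4 := m1 d (hDE hd)
  rcases h8 with h8 | h8 <;> rcases h9 with h9 | h9
  · exact n1.elim (h8 a ha) (h9 a ha)
  · exact n3.elim (fun h => h8 c h hc) (fun h => h9 c h hc)
  · exact n4.elim (fun h => h9 d h hd) (fun h => h8 d h hd)
  · exact n2.elim (h9 b hb) (h8 b hb)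

/-- A connected minor of a matroid with a separator `A` that meets `A` is a minor of the
restriction to `A`. -/
theorem IsConnected.isMinor_restrict [M.Finite] (h : IsConnected M') (hM' : M' ≤m M) {A : Set β}
    (hA : A ⊆ M.E) (hsep : rk M A + rk M (M.E \ A) ≤ rk M M.E) (heM' : e ∈ M'.E) (heA : e ∈ A) :
    M' ≤m M ↾ A := by
  obtain ⟨C, D, hC, hD, hCD, rfl⟩ := hM'.exists_eq_contract_delete_disjoint
  have : (M ／ C ＼ D).Finite := minor_finite hM'
  have : (M ↾ A).Finite := ⟨M.ground_finite.subset hA⟩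
  set M' := M ／ C ＼ D with hM'def
  have hE' : M'.E = (M.E \ C) \ D := rfl
  -- The additivity of rank at the separator passes to every subset of the ground set.
  have hsum : ∀ X ⊆ M.E, rk M X = rk M (X ∩ A) + rk M (X \ A) := by
    intro X hX
    have h1 := rk_union_le M (X ∩ A) (X \ A)
    rw [inter_union_sdiff] at h1
    have h2 := rk_submod_of_subset M (X := X) (Y := A) (A := X ∩ A) (B := X ∪ A) Subset.rfl
      Subset.rfl
    have h3 := rk_submod_of_subset M (X := X ∪ A) (Y := M.E \ A) (A := X \ A) (B := M.E)
      (fun y hy => ⟨Or.inl hy.1, hX hy.1, hy.2⟩)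
      (fun y hy => (em (y ∈ A)).elim (fun h => Or.inl (Or.inr h)) fun h => Or.inr ⟨hy, h⟩)
    omega
  have hsub : M'.E ⊆ A := by
    by_contra hcon
    obtain ⟨y, hy, hyA⟩ := not_subset.1 hcon
    have h1 := h (M'.E ∩ A) inter_subset_left ⟨e, heM', heA⟩ ⟨y, hy, fun h => hyA h.2⟩
    rw [sdiff_self_inter] at h1
    have h2 := rk_minor M (C := C) (D := D) (X := M'.E ∩ A) inter_subset_left
    have h3 := rk_minor M (C := C) (D := D) (X := M'.E \ A) sdiff_subset
    have h4 := rk_minor M (C := C) (D := D) (X := M'.E) Subset.rfl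
    have hME : M'.E ⊆ M.E := hM'.subset
    have h5 := hsum (M'.E ∩ A ∪ C) (union_subset (inter_subset_left.trans hME) hC)
    have h6 := hsum (M'.E \ A ∪ C) (union_subset (sdiff_subset.trans hME) hC)
    have h7 := hsum (M'.E ∪ C) (union_subset hME hC)
    have h8 := hsum C hC
    have e1 : (M'.E ∩ A ∪ C) ∩ A = (M'.E ∪ C) ∩ A := by ext; simp; tauto
    have e2 : (M'.E ∩ A ∪ C) \ A = C \ A := by ext; simp; tauto
    have e3 : (M'.E \ A ∪ C) ∩ A = C ∩ A := by ext; simp; tauto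
    have e4 : (M'.E \ A ∪ C) \ A = (M'.E ∪ C) \ A := by ext; simp; tauto
    rw [e1, e2] at h5
    rw [e3, e4] at h6
    rw [← hM'def] at h2 h3 h4
    omega
  have hEA : ((M ↾ A) ／ (C ∩ A) ＼ D).E = M'.E := by
    ext y
    have h1 : y ∈ M'.E → y ∈ A := fun hy => hsub hy
    rw [hE'] at h1 ⊢
    simp only [delete_ground, contract_ground, restrict_ground_eq, mem_sdiff, mem_inter_iff] at *
    constructor
    · rintro ⟨⟨h2, h3⟩, h4⟩
      exact ⟨⟨hA h2, fun h => h3 ⟨h, h2⟩⟩, h4⟩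
    · rintro ⟨⟨h2, h3⟩, h4⟩
      exact ⟨⟨h1 ⟨⟨h2, h3⟩, h4⟩, fun h => h3 h.1⟩, h4⟩
  have : ((M ↾ A) ／ (C ∩ A) ＼ D).Finite := minor_finite (contract_delete_isMinor _ _ _)
  have : M' = (M ↾ A) ／ (C ∩ A) ＼ D := by
    refine eq_of_rk hEA.symm fun X hX => ?_
    have h1 := rk_minor M (C := C) (D := D) hX
    have h2 := rk_minor (M ↾ A) (C := C ∩ A) (D := D) (X := X) (hEA.symm ▸ hX)
    rw [rk_restrict, rk_restrict, inter_assoc, inter_self] at h2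
    have h3 := hsum (X ∪ C) (union_subset (hX.trans hM'.subset) hC)
    have h4 := hsum C hC
    have hXA : X ⊆ A := hX.trans hsub
    have e1 : (X ∪ C ∩ A) ∩ A = (X ∪ C) ∩ A := by ext; simp; tauto
    have e2 : (X ∪ C) \ A = C \ A := by
      rw [union_sdiff_distrib, sdiff_eq_empty.2 hXA, empty_union]
    rw [e1] at h2
    rw [e2] at h3
    rw [← hM'def] at h1
    omega
  rw [this]
  exact contract_delete_isMinor _ _ _

/-- To prove that a connected matroid `N` has the transitivity property it is enough to show that
any two elements of a connected matroid with an `N`-minor are in an `N`-minor together. -/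
theorem hasTransitivityProperty_of_isConnected {N : Matroid α} (hfin : N.Finite)
    (hN : IsConnected N)
    (h : ∀ (β : Type v) (M : Matroid β), M.Finite → IsConnected M →
      (∃ M', M' ≤m M ∧ IsIso M' N) → ∀ e g, e ∈ M.E → g ∈ M.E → e ≠ g →
      InMinorTogether N M e g) : HasTransitivityProperty.{u, v} N := by
  intro β M hM e f g he hf hg hef hfg heg h1 h2
  induction hn : M.E.ncard using Nat.strong_induction_on generalizing M with
  | _ n ih =>
  obtain ⟨M₁, hM₁, hI₁, he₁, hf₁⟩ := h1
  obtain ⟨M₂, hM₂, hI₂, hf₂, hg₂⟩ := h2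
  have : M₁.Finite := minor_finite hM₁
  have : M₂.Finite := minor_finite hM₂
  by_cases hconn : IsConnected M
  · exact h β M hM hconn ⟨M₁, hM₁, hI₁⟩ e g he hg heg
  unfold IsConnected at hconn
  push Not at hconn
  obtain ⟨A, hA, hAne, hBne, hAB⟩ := hconn
  -- The side of the separation containing `e` contains all of `M₁`, hence `f`, hence all of `M₂`;
  -- induction applies to the restriction to that side.
  have key : ∀ A ⊆ M.E, (M.E \ A).Nonempty → rk M A + rk M (M.E \ A) ≤ rk M M.E → e ∈ A →
      InMinorTogether N M e g := by
    intro A hA hBne hAB heA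
    have m1 := (hN.of_isIso hI₁.symm).isMinor_restrict hM₁ hA hAB he₁ heA
    have hfA : f ∈ A := m1.subset hf₁
    have m2 := (hN.of_isIso hI₂.symm).isMinor_restrict hM₂ hA hAB hf₂ hfA
    obtain ⟨M₃, hM₃, h3⟩ := ih A.ncard (by
        rw [← hn]
        obtain ⟨b, hb⟩ := hBne
        exact ncard_lt_ncard ⟨hA, fun h => hb.2 (h hb.1)⟩ M.ground_finite) (M ↾ A)
      ⟨M.ground_finite.subset hA⟩ heA hfA (m2.subset hg₂) ⟨M₁, m1, hI₁, he₁, hf₁⟩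
      ⟨M₂, m2, hI₂, hf₂, hg₂⟩ rfl
    exact ⟨M₃, hM₃.trans (restrict_isMinor M hA), h3⟩
  by_cases heA : e ∈ A
  · exact key A hA hBne hAB heA
  · refine key (M.E \ A) sdiff_subset ?_ ?_ ⟨he, heA⟩
    · rwa [sdiff_sdiff_cancel_left hA]
    · rwa [sdiff_sdiff_cancel_left hA, add_comm]

theorem IsConnected.inMinorTogether_uniformMatroid [M.Finite] (h : IsConnected M) (he : e ∈ M.E)
    (hg : g ∈ M.E) (heg : e ≠ g) : InMinorTogether (uniformMatroid 1 2) M e g := by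
  induction hn : M.E.ncard using Nat.strong_induction_on generalizing M with
  | _ n ih =>
  by_cases hE : M.E ⊆ {e, g}
  · have hE' : M.E = {e, g} := hE.antisymm (pair_subset he hg)
    have h1 := h.rk_singleton he hg heg
    have h2 := h.rk_singleton hg he heg.symm
    have h3 := h {e} (singleton_subset_iff.2 he) (singleton_nonempty e) ⟨g, hg, heg.symm⟩
    have h4 : M.E \ {e} = {g} := by
      rw [hE']; ext; simp; grind
    have h5 := rk_mono M (singleton_subset_iff.2 he)
    rw [h4] at h3
    exact ⟨M, IsMinor.refl, isIso_uniformMatroid_one_two hE' heg h1 h2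
      (by rw [← hE']; omega), he, hg⟩
  · obtain ⟨x, hx, hxe⟩ := not_subset.1 hE
    simp only [mem_insert_iff, mem_singleton_iff, not_or] at hxe
    have hlt : (M.E \ {x}).ncard < n := by
      rw [← hn]
      exact ncard_sdiff_singleton_lt_of_mem hx M.ground_finite
    have he' : e ∈ M.E \ {x} := ⟨he, fun h => hxe.1 h.symm⟩
    have hg' : g ∈ M.E \ {x} := ⟨hg, fun h => hxe.2 h.symm⟩
    rcases h.delete_or_contract x with h1 | h1
    · obtain ⟨M', hM', h2⟩ := @ih _ hlt (M ＼ {x})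
        (minor_finite (delete_isMinor M {x})) h1 he' hg' rfl
      exact ⟨M', hM'.trans (delete_isMinor M {x}), h2⟩
    · obtain ⟨M', hM', h2⟩ := @ih _ hlt (M ／ {x})
        (minor_finite (contract_isMinor M {x})) h1 he' hg' rfl
      exact ⟨M', hM'.trans (contract_isMinor M {x}), h2⟩

end Connected

/-! ### Ranks, connectivity and self-duality of the rank-two wheel. -/

section WheelRank

theorem wheelMatroidTwo_rk_pair {i j : Fin 2 ⊕ Fin 2} (hij : i ≠ j)
    (h : ¬ (Sum.inr 0 ∈ ({i, j} : Set (Fin 2 ⊕ Fin 2)) ∧ Sum.inr 1 ∈ ({i, j} : Set _))) :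
    rk wheelMatroidTwo {i, j} = 2 := by
  rw [(indep_iff_rk _ (toFinite _)).1 (wheelMatroidTwo_indep_iff.2 ⟨(ncard_pair hij).le, h⟩),
    ncard_pair hij]

theorem wheelMatroidTwo_rk_rim : rk wheelMatroidTwo {Sum.inr 0, Sum.inr 1} = 1 := by
  have h1 : ¬ wheelMatroidTwo.Indep {Sum.inr 0, Sum.inr 1} := by
    rw [wheelMatroidTwo_indep_iff]; simp
  rw [indep_iff_rk _ (toFinite _), ncard_pair (by simp)] at h1
  have h2 := rk_le_ncard wheelMatroidTwo (toFinite {Sum.inr 0, Sum.inr 1})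
  rw [ncard_pair (by simp)] at h2
  have h3 : wheelMatroidTwo.Indep {Sum.inr 0} := by
    rw [wheelMatroidTwo_indep_iff]; simp
  have h4 := ncard_le_rk _ h3 (X := {Sum.inr 0, Sum.inr 1}) (by simp)
  rw [ncard_singleton] at h4
  omega

theorem wheelMatroidTwo_rk_univ : rk wheelMatroidTwo univ = 2 := by
  obtain ⟨I, -, hI, -, hc⟩ := exists_indep_ncard wheelMatroidTwo univ
  have h1 := (wheelMatroidTwo_indep_iff.1 hI).1
  have h2 := rk_mono wheelMatroidTwo (subset_univ {Sum.inl 0, Sum.inr 0})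
  rw [wheelMatroidTwo_rk_pair (by simp) (by simp)] at h2
  omega

/-- One side of any bipartition contains a pair other than the rim pair, hence has full rank, and
the other side has a nonloop. -/
theorem wheelMatroidTwo_isConnected : IsConnected wheelMatroidTwo := by
  have hs : ∀ i, wheelMatroidTwo.Indep {i} := fun i => by
    rw [wheelMatroidTwo_indep_iff, ncard_singleton]
    exact ⟨by norm_num, fun h => by have := h.1.trans h.2.symm; simp at this⟩
  have key : ∀ A : Finset (Fin 2 ⊕ Fin 2), ∃ i j, i ≠ j ∧ ¬ (i = Sum.inr 0 ∧ j = Sum.inr 1) ∧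
      ¬ (i = Sum.inr 1 ∧ j = Sum.inr 0) ∧ ((i ∈ A ∧ j ∈ A) ∨ (i ∉ A ∧ j ∉ A)) := by
    decide
  intro A hA ⟨a, ha⟩ ⟨b, hb⟩
  have hone : ∀ i X, i ∈ X → 1 ≤ rk wheelMatroidTwo X := fun i X h => by
    rw [← ncard_singleton i]
    exact ncard_le_rk _ (hs i) (singleton_subset_iff.2 h)
  have h1 := hone a A ha
  have h2 := hone b _ hb
  rw [wheelMatroidTwo_ground] at *
  rw [wheelMatroidTwo_rk_univ]
  obtain ⟨i, j, hij, h3, h4, h5⟩ := key A.toFinite.toFinset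
  simp only [Finite.mem_toFinset] at h5
  have h6 := wheelMatroidTwo_rk_pair hij (by
    simp only [mem_insert_iff, mem_singleton_iff]
    rintro ⟨h | h, h' | h'⟩
    · have := h.trans h'.symm; simp at this
    · exact h3 ⟨h.symm, h'.symm⟩
    · exact h4 ⟨h'.symm, h.symm⟩
    · have := h.trans h'.symm; simp at this)
  rcases h5 with h5 | h5
  · have := rk_mono wheelMatroidTwo (pair_subset h5.1 h5.2)
    omega
  · have := rk_mono wheelMatroidTwo (pair_subset (s := univ \ A) ⟨trivial, h5.1⟩ ⟨trivial, h5.2⟩)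
    omega

/-- Duality exchanges spokes and rim edges: the two spokes become the parallel pair. -/
theorem isIso_dual_wheelMatroidTwo : IsIso wheelMatroidTwo✶ wheelMatroidTwo := by
  have hE : wheelMatroidTwo✶.E = univ := rfl
  have huniv : (univ : Set (Fin 2 ⊕ Fin 2)) = {Sum.inl 0, Sum.inl 1, Sum.inr 0, Sum.inr 1} := by
    ext i; rcases i with i | i <;> fin_cases i <;> simp
  have hd : ∀ i j k l : Fin 2 ⊕ Fin 2, i ≠ j → ({i, j} : Set _)ᶜ = {k, l} →
      rk wheelMatroidTwo✶ {i, j} = rk wheelMatroidTwo {k, l} := by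
    intro i j k l hij h
    have h1 := rk_dual_pair wheelMatroidTwo_ground hij
    rw [wheelMatroidTwo_rk_univ, h] at h1
    omega
  have hc : ∀ i j k l : Fin 2 ⊕ Fin 2, (∀ x, x ∈ ({i, j} : Finset _) ↔ x ∉ ({k, l} : Finset _)) →
      ({i, j} : Set (Fin 2 ⊕ Fin 2))ᶜ = {k, l} := by
    intro i j k l h
    ext x
    have := h x
    simp at this ⊢
    tauto
  refine isIso_wheelMatroidTwo (p := Sum.inl 0) (p' := Sum.inl 1) (q := Sum.inr 0)
    (k := Sum.inr 1) (hE.trans huniv) ?_ (by simp) ?_ ?_ ?_ ?_ ?_ ?_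
  · rw [hd _ _ (Sum.inr 0) (Sum.inr 1) (by simp) (hc _ _ _ _ (by decide)), wheelMatroidTwo_rk_rim]
  · rw [hd _ _ (Sum.inl 1) (Sum.inr 1) (by simp) (hc _ _ _ _ (by decide)),
      wheelMatroidTwo_rk_pair (by simp) (by simp)]
  · rw [hd _ _ (Sum.inl 1) (Sum.inr 0) (by simp) (hc _ _ _ _ (by decide)),
      wheelMatroidTwo_rk_pair (by simp) (by simp)]
  · rw [hd _ _ (Sum.inl 0) (Sum.inr 1) (by simp) (hc _ _ _ _ (by decide)),
      wheelMatroidTwo_rk_pair (by simp) (by simp)]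
  · rw [hd _ _ (Sum.inl 0) (Sum.inr 0) (by simp) (hc _ _ _ _ (by decide)),
      wheelMatroidTwo_rk_pair (by simp) (by simp)]
  · rw [hd _ _ (Sum.inl 0) (Sum.inl 1) (by simp) (hc _ _ _ _ (by decide)),
      wheelMatroidTwo_rk_pair (by simp) (by simp)]
  · have h1 := rk_dual_add_rk_univ wheelMatroidTwo_ground univ
    rw [compl_univ, rk_empty, wheelMatroidTwo_rk_univ, ncard_univ] at h1
    rw [hE]
    simp at h1
    omega

end WheelRank

/-! ### Uniform matroids and a criterion for wheel minors. -/

section Uniform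

variable {β : Type v} {M M' : Matroid β} {e g x : β}

/-- A matroid is uniform if each subset of the ground set is independent or spanning. -/
def IsUniform (M : Matroid β) : Prop := ∀ X ⊆ M.E, rk M X = X.ncard ∨ rk M X = rk M M.E

theorem IsUniform.isMinor [M.Finite] (h : IsUniform M) (hM' : M' ≤m M) : IsUniform M' := by
  obtain ⟨C, D, hC, hD, hCD, rfl⟩ := hM'.exists_eq_contract_delete_disjoint
  have : (M ／ C ＼ D).Finite := minor_finite hM'
  intro X hX
  have hXf : X.Finite := (M ／ C ＼ D).ground_finite.subset hX
  have hCf : C.Finite := M.ground_finite.subset hC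
  have h1 := rk_minor M (C := C) (D := D) hX
  have h2 := rk_minor M (C := C) (D := D) (X := (M ／ C ＼ D).E) Subset.rfl
  have h3 := rk_le_ncard (M ／ C ＼ D) hXf
  have h4 := rk_mono (M ／ C ＼ D) hX
  rcases h (X ∪ C) (union_subset (hX.trans hM'.subset) hC) with h5 | h5
  · left
    have h6 : Disjoint X C := disjoint_left.2 fun y hy hyC => (hX hy).1.2 hyC
    rw [ncard_union_eq h6 hXf hCf] at h5
    have h7 := rk_le_ncard M hCf
    omega
  · right
    have h6 := rk_mono M (union_subset hM'.subset hC)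
    omega

theorem IsUniform.dual [M.Finite] (h : IsUniform M) : IsUniform M✶ := by
  intro X hX
  rw [dual_ground] at *
  have h1 := rk_dual M hX
  have h2 := rk_dual M (X := M.E) Subset.rfl
  have h3 := ncard_sdiff_add_ncard_of_subset hX M.ground_finite
  rw [sdiff_self, rk_empty] at h2
  rcases h (M.E \ X) sdiff_subset with h4 | h4
  · right; omega
  · left; omega

/-- The rim pair is neither independent nor spanning. -/
theorem not_isUniform_of_isIso_wheelMatroidTwo [M.Finite] (h : IsIso M wheelMatroidTwo) :
    ¬ IsUniform M := by
  intro hM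
  obtain ⟨f, hf, hr⟩ := h.symm.exists_bijOn_rk ⟨Sum.inl 0, mem_univ _⟩
  have h1 := hM (f '' {Sum.inr 0, Sum.inr 1}) (hf.image_eq ▸ image_mono (subset_univ _))
  rw [(hf.injOn.mono (subset_univ _)).ncard_image, ncard_pair (by simp), hr _ (subset_univ _),
    ← hf.image_eq, hr _ Subset.rfl, wheelMatroidTwo_rk_rim, wheelMatroidTwo_ground,
    wheelMatroidTwo_rk_univ] at h1
  omega

/-- A criterion for two elements to be in a minor isomorphic to the wheel of rank two together. -/
theorem inMinorTogether_wheelMatroidTwo [M.Finite] {I : Set β} {p p' q k : β} (hI : I ⊆ M.E)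
    (hE : {p, p', q, k} ⊆ M.E \ I) (hpp' : p ≠ p') (hrI : rk M I + 2 = rk M M.E)
    (hp : rk M ({p, p'} ∪ I) < rk M M.E) (hpq : rk M M.E ≤ rk M ({p, q} ∪ I))
    (hpk : rk M M.E ≤ rk M ({p, k} ∪ I)) (hpq' : rk M M.E ≤ rk M ({p', q} ∪ I))
    (hpk' : rk M M.E ≤ rk M ({p', k} ∪ I)) (hqk : rk M M.E ≤ rk M ({q, k} ∪ I))
    (he : e ∈ ({p, p', q, k} : Set β)) (hg : g ∈ ({p, p', q, k} : Set β)) :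
    InMinorTogether wheelMatroidTwo M e g := by
  obtain ⟨D, hD⟩ : ∃ D, D = (M.E \ I) \ {p, p', q, k} := ⟨_, rfl⟩
  have hmE : (M ／ I ＼ D).E = {p, p', q, k} := by
    rw [delete_ground, contract_ground, hD, sdiff_sdiff_cancel_left hE]
  have hm : ∀ a b, a ∈ ({p, p', q, k} : Set β) → b ∈ ({p, p', q, k} : Set β) →
      rk (M ／ I ＼ D) {a, b} + rk M I = rk M ({a, b} ∪ I) := fun a b ha hb =>
    rk_minor M (by rw [hmE]; exact pair_subset ha hb)
  have hle : ∀ a b, rk M ({a, b} ∪ I) ≤ rk M I + 2 := fun a b => by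
    have h1 := rk_union_le M {a, b} I
    have h2 := rk_insert_le M a {b}
    have h3 := rk_singleton_le M b
    omega
  have hm2 : ∀ a b, a ∈ ({p, p', q, k} : Set β) → b ∈ ({p, p', q, k} : Set β) →
      rk M M.E ≤ rk M ({a, b} ∪ I) → rk (M ／ I ＼ D) {a, b} = 2 := fun a b ha hb h => by
    have h1 := hm a b ha hb
    have h2 := hle a b
    omega
  refine ⟨M ／ I ＼ D, contract_delete_isMinor _ _ _, isIso_wheelMatroidTwo hmE ?_ hpp'
    (hm2 _ _ (by simp) (by simp) hpq) (hm2 _ _ (by simp) (by simp) hpk)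
    (hm2 _ _ (by simp) (by simp) hpq') (hm2 _ _ (by simp) (by simp) hpk')
    (hm2 _ _ (by simp) (by simp) hqk) ?_, hmE.symm ▸ he, hmE.symm ▸ hg⟩
  · have := hm p p' (by simp) (by simp)
    omega
  · have h1 := rk_minor M (C := I) (D := D) (X := (M ／ I ＼ D).E) Subset.rfl
    have h2 : (M ／ I ＼ D).E ∪ I ⊆ M.E :=
      union_subset (contract_delete_isMinor M I D).subset hI
    have h3 := rk_mono M h2
    omega

end Uniform

/-! ### Wheel minors in one-element extensions of uniform matroids. -/

section SingleElementExtension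

variable {β : Type v} {M : Matroid β} {e g x : β} {F D : Set β} {r : ℕ}

/-- `x` is spanned by `D` but not by `D \ {d}`. Contracting r - 2 elements of `F` that include `D \
{d}` makes `x` parallel to `d`, while `d`, `a`, `b` stay in general position. The bounds |D| - 1 ≤ r
- 2 ≤ |F| - 3 leave room for this. -/
theorem inMinorTogether_wheelMatroidTwo_of_mem [M.Finite] (hE : M.E = insert x F) (hxF : x ∉ F)
    (hF : ∀ X ⊆ F, rk M X = min X.ncard r) (hr : rk M M.E = r) (hrF : r < F.ncard)
    (hDF : D ⊆ F) (hDr : D.ncard < r) (hD : rk M (insert x D) = D.ncard) {d a b : β} (hd : d ∈ D)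
    (hDd : rk M (insert x (D \ {d})) = D.ncard) (ha : a ∈ F \ D) (hb : b ∈ F \ D) (hab : a ≠ b)
    (he : e ∈ ({d, a, b} : Set β)) (hg : g ∈ ({d, a, b} : Set β)) :
    InMinorTogether wheelMatroidTwo M e g := by
  have hFE : F ⊆ M.E := hE ▸ subset_insert x F
  have hFfin : F.Finite := M.ground_finite.subset hFE
  have hda : d ≠ a := fun h => ha.2 (h ▸ hd)
  have hdb : d ≠ b := fun h => hb.2 (h ▸ hd)
  have hsub : ({d, a, b} : Set β) ⊆ F := by
    rintro y (rfl | rfl | rfl)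
    exacts [hDF hd, ha.1, hb.1]
  have hcard : ({d, a, b} : Set β).ncard = 3 := ncard_eq_three.2 ⟨d, a, b, hda, hdb, hab, rfl⟩
  have h1 := ncard_sdiff_add_ncard_of_subset hsub hFfin
  have h2 := ncard_sdiff_singleton_add_one hd (hFfin.subset hDF)
  have : Finite (F \ {d, a, b} : Set β) := hFfin.subset sdiff_subset
  obtain ⟨I, hDI, hIF, hIc⟩ := exists_subsuperset_card_eq (s := D \ {d}) (t := F \ {d, a, b})
    (n := r - 2) (by
      rintro y ⟨hy, hyd⟩
      refine ⟨hDF hy, ?_⟩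
      rintro (h | h | h)
      exacts [hyd h, ha.2 (h ▸ hy), hb.2 (h ▸ hy)]) (by omega) (by omega)
  have hIF' : I ⊆ F := hIF.trans sdiff_subset
  have hIfin : I.Finite := hFfin.subset hIF'
  have hdI : d ∉ I := fun h => (hIF h).2 (by simp)
  have haI : a ∉ I := fun h => (hIF h).2 (by simp)
  have hbI : b ∉ I := fun h => (hIF h).2 (by simp)
  have hxI : x ∉ I := fun h => hxF (hIF' h)
  have hDI' : D ⊆ insert d I := by
    rw [← sdiff_singleton_subset_iff]; exact hDI
  have hrI : rk M I = r - 2 := by rw [hF I hIF', hIc]; omega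
  have hrdI : rk M (insert d I) = r - 1 := by
    rw [hF _ (insert_subset (hDF hd) hIF'), ncard_insert_of_notMem hdI hIfin, hIc]; omega
  have hpair : ∀ y z, y ∈ F → z ∈ F → y ∉ I → z ∉ I → y ≠ z → rk M ({y, z} ∪ I) = r := by
    intro y z hy hz hyI hzI hyz
    rw [insert_union, singleton_union, hF _ (insert_subset hy (insert_subset hz hIF')),
      ncard_insert_of_notMem (by simp [hyz, hyI]) (hIfin.insert z), ncard_insert_of_notMem hzI hIfin]
    omega
  have hxd : rk M ({x, d} ∪ I) < r := by
    have h3 := rk_submod_of_subset M (X := insert d I) (Y := insert x D) (A := D)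
      (B := {x, d} ∪ I) (subset_inter hDI' (subset_insert x D)) (by
        rintro y ((rfl | rfl) | hy)
        exacts [Or.inr (mem_insert y _), Or.inl (mem_insert y _), Or.inl (Or.inr hy)])
    rw [hF D hDF] at h3
    omega
  have hxI' : r - 1 ≤ rk M (insert x I) := by
    have h3 := rk_submod_of_subset M (X := insert x I) (Y := insert x D) (A := insert x (D \ {d}))
      (B := insert d I) (subset_inter (insert_subset_insert hDI)
        (insert_subset_insert sdiff_subset)) (by
        rintro y (rfl | hy)
        exacts [Or.inr (Or.inr hd), Or.inl (Or.inr hy)])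
    omega
  have hxy : ∀ y, y ∈ F → y ∉ I → d ≠ y → r ≤ rk M ({x, y} ∪ I) := by
    intro y hy hyI hdy
    have h3 := rk_submod_of_subset M (X := {x, y} ∪ I) (Y := {x, d} ∪ I) (A := insert x I)
      (B := {d, y} ∪ I) (by
        rintro z (rfl | hz)
        · exact ⟨Or.inl (mem_insert z _), Or.inl (mem_insert z _)⟩
        · exact ⟨Or.inr hz, Or.inr hz⟩) (by
        rintro z ((rfl | rfl) | hz)
        · exact Or.inr (Or.inl (by simp))
        · exact Or.inl (Or.inl (by simp))
        · exact Or.inl (Or.inr hz))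
    rw [hpair d y (hDF hd) hy hdI hyI hdy] at h3
    omega
  refine inMinorTogether_wheelMatroidTwo (I := I) (p := x) (p' := d) (q := a) (k := b)
    (hIF'.trans hFE) ?_ (fun h => hxF (h ▸ hDF hd)) (by omega) (hr ▸ hxd)
    (hr ▸ hxy a ha.1 haI hda) (hr ▸ hxy b hb.1 hbI hdb)
    (by rw [hpair d a (hDF hd) ha.1 hdI haI hda, hr])
    (by rw [hpair d b (hDF hd) hb.1 hdI hbI hdb, hr])
    (by rw [hpair a b ha.1 hb.1 haI hbI hab, hr]) (Or.inr he) (Or.inr hg)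
  rintro y (rfl | hy)
  · exact ⟨hE ▸ mem_insert y F, hxI⟩
  · exact ⟨hFE (hsub hy), fun h => (hIF h).2 hy⟩

/-- Now `x` itself is contracted, with r - 3 elements that include `D \ {e, g}`. This makes `e` and
`g` parallel. Small sets missing `e` or `g` never span `x`, so the other pairs keep full rank. -/
theorem inMinorTogether_wheelMatroidTwo_of_forall_mem [M.Finite] (hE : M.E = insert x F)
    (hxF : x ∉ F) (hF : ∀ X ⊆ F, rk M X = min X.ncard r) (hr : rk M M.E = r) (hrF : r < F.ncard)
    (hDF : D ⊆ F) (hDr : D.ncard < r) (hD : rk M (insert x D) = D.ncard) (heg : e ≠ g)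
    (h : ∀ D' ⊆ F, D'.ncard < r → rk M (insert x D') = D'.ncard → e ∈ D' ∧ g ∈ D') :
    InMinorTogether wheelMatroidTwo M e g := by
  have hFE : F ⊆ M.E := hE ▸ subset_insert x F
  have hFfin : F.Finite := M.ground_finite.subset hFE
  have hDfin : D.Finite := hFfin.subset hDF
  have hxr : ∀ X ⊆ F, X.ncard < r → ¬ (e ∈ X ∧ g ∈ X) → rk M (insert x X) = X.ncard + 1 := by
    intro X hX hXr heX
    have h1 := hF X hX
    have h2 := rk_mono M (subset_insert x X)
    have h3 := rk_insert_le M x X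
    have h4 : rk M (insert x X) ≠ X.ncard := fun h' => heX (h X hX hXr h')
    omega
  obtain ⟨he, hg⟩ := h D hDF hDr hD
  have h1 := ncard_sdiff_add_ncard_of_subset hDF hFfin
  obtain ⟨a, ha, b, hb, hab⟩ := (one_lt_ncard (hFfin.subset sdiff_subset)).1
    (show 1 < (F \ D).ncard by omega)
  have hea : e ≠ a := fun h => ha.2 (h ▸ he)
  have heb : e ≠ b := fun h => hb.2 (h ▸ he)
  have hga : g ≠ a := fun h => ha.2 (h ▸ hg)
  have hgb : g ≠ b := fun h => hb.2 (h ▸ hg)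
  have hsub : ({e, g, a, b} : Set β) ⊆ F := by
    rintro y (rfl | rfl | rfl | rfl)
    exacts [hDF he, hDF hg, ha.1, hb.1]
  have hcard : ({e, g, a, b} : Set β).ncard = 4 := by
    rw [ncard_insert_of_notMem (by simp [heg, hea, heb]),
      ncard_eq_three.2 ⟨g, a, b, hga, hgb, hab, rfl⟩]
  have h2 := ncard_sdiff_add_ncard_of_subset hsub hFfin
  have h3 := ncard_sdiff_add_ncard_of_subset (pair_subset he hg) hDfin
  rw [ncard_pair heg] at h3
  have : Finite (F \ {e, g, a, b} : Set β) := hFfin.subset sdiff_subset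
  obtain ⟨J, hDJ, hJF, hJc⟩ := exists_subsuperset_card_eq (s := D \ {e, g})
    (t := F \ {e, g, a, b}) (n := r - 3) (by
      rintro y ⟨hy, hyd⟩
      refine ⟨hDF hy, ?_⟩
      rintro (h | h | h | h)
      exacts [hyd (Or.inl h), hyd (Or.inr h), ha.2 (h ▸ hy), hb.2 (h ▸ hy)]) (by omega) (by omega)
  have hJF' : J ⊆ F := hJF.trans sdiff_subset
  have hJfin : J.Finite := hFfin.subset hJF'
  have heJ : e ∉ J := fun h => (hJF h).2 (by simp)
  have hgJ : g ∉ J := fun h => (hJF h).2 (by simp)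
  have haJ : a ∉ J := fun h => (hJF h).2 (by simp)
  have hbJ : b ∉ J := fun h => (hJF h).2 (by simp)
  have hc : ∀ y z, y ∉ J → z ∉ J → y ≠ z → ({y, z} ∪ J : Set β).ncard = r - 1 := by
    intro y z hyJ hzJ hyz
    rw [insert_union, singleton_union, ncard_insert_of_notMem (by simp [hyz, hyJ])
      (hJfin.insert z), ncard_insert_of_notMem hzJ hJfin, hJc]
    omega
  have hpair : ∀ y z, y ∈ F → z ∈ F → y ∉ J → z ∉ J → y ≠ z → ¬ (e ∈ ({y, z} : Set β) ∧
      g ∈ ({y, z} : Set β)) → rk M M.E ≤ rk M ({y, z} ∪ insert x J) := by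
    intro y z hy hz hyJ hzJ hyz hne
    have h4 := hc y z hyJ hzJ hyz
    rw [union_insert, hxr _ (union_subset (pair_subset hy hz) hJF') (by omega)
      (fun h => hne ⟨h.1.resolve_right heJ, h.2.resolve_right hgJ⟩)]
    omega
  have hrI := hxr J hJF' (by omega) (fun h => heJ h.1)
  have hxF' : ∀ y ∈ F, y ≠ x := fun y hy h => hxF (h ▸ hy)
  refine inMinorTogether_wheelMatroidTwo (I := insert x J) (p := e) (p' := g) (q := a) (k := b)
    (hE ▸ insert_subset_insert hJF') ?_ heg (by omega) ?_
    (hpair e a (hDF he) ha.1 heJ haJ hea (by simp [heg.symm, hga]))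
    (hpair e b (hDF he) hb.1 heJ hbJ heb (by simp [heg.symm, hgb]))
    (hpair g a (hDF hg) ha.1 hgJ haJ hga (by simp [heg, hea]))
    (hpair g b (hDF hg) hb.1 hgJ hbJ hgb (by simp [heg, heb]))
    (hpair a b ha.1 hb.1 haJ hbJ hab (by simp [hea, heb])) (by simp) (by simp)
  · intro y hy
    refine ⟨hFE (hsub hy), ?_⟩
    rintro (h | h)
    exacts [hxF' y (hsub hy) h, (hJF h).2 hy]
  · have h4 := rk_submod_of_subset M (X := {e, g} ∪ J) (Y := insert x D) (A := D)
      (B := {e, g} ∪ insert x J) (subset_inter (by rwa [← sdiff_subset_iff]) (subset_insert x D)) (by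
        rw [union_insert]
        exact insert_subset (Or.inr (mem_insert x D)) subset_union_left)
    rw [hF D hDF, hF _ (union_subset (pair_subset (hDF he) (hDF hg)) hJF'),
      hc e g heJ hgJ heg] at h4
    omega

/-- The case of a nonuniform matroid with a uniform single-element deletion. -/
theorem inMinorTogether_wheelMatroidTwo_of_uniform [M.Finite] (hE : M.E = insert x F)
    (hxF : x ∉ F) (hF : ∀ X ⊆ F, rk M X = min X.ncard r) (hr : rk M M.E = r) (hrF : r < F.ncard)
    (hx : rk M {x} = 1) (hDF : D ⊆ F) (hDr : D.ncard < r) (hD : rk M (insert x D) = D.ncard)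
    (he : e ∈ F) (hg : g ∈ F) (heg : e ≠ g) : InMinorTogether wheelMatroidTwo M e g := by
  have hFfin : F.Finite := M.ground_finite.subset (hE ▸ subset_insert x F)
  by_cases h : ∀ D' ⊆ F, D'.ncard < r → rk M (insert x D') = D'.ncard → e ∈ D' ∧ g ∈ D'
  · exact inMinorTogether_wheelMatroidTwo_of_forall_mem hE hxF hF hr hrF hDF hDr hD heg h
  push Not at h
  obtain ⟨D', h⟩ := h
  -- Not containing both `e` and `g` is inherited by subsets, so a smallest such set spans `x` while
  -- none of its subsets with one element removed does.
  obtain ⟨D, ⟨hDF, hDr, hD, hne⟩, hmin⟩ := (measure (ncard (α := β))).wf.has_min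
    {D' : Set β | D' ⊆ F ∧ D'.ncard < r ∧ rk M (insert x D') = D'.ncard ∧ (e ∈ D' → g ∉ D')}
    ⟨D', h⟩
  have hDfin : D.Finite := hFfin.subset hDF
  have hDd : ∀ d ∈ D, rk M (insert x (D \ {d})) = D.ncard := by
    intro d hd
    have h1 := ncard_sdiff_singleton_add_one hd hDfin
    have h2 := hF (D \ {d}) (sdiff_subset.trans hDF)
    have h3 := rk_mono M (subset_insert x (D \ {d}))
    have h4 := rk_insert_le M x (D \ {d})
    by_contra hcon
    refine hmin (D \ {d}) ⟨sdiff_subset.trans hDF, by omega, by omega,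
      fun h h' => hne h.1 h'.1⟩ ?_
    change (D \ {d}).ncard < D.ncard
    omega
  have key : ∀ e g, e ∈ F → g ∈ F → e ≠ g → (e ∈ D → g ∉ D) → e ∈ D →
      InMinorTogether wheelMatroidTwo M e g := by
    intro e g he hg heg hne heD
    obtain ⟨b, hb, hbD⟩ := exists_mem_notMem_of_ncard_lt_ncard
      (show (insert g D).ncard < F.ncard from (ncard_insert_le g D).trans_lt (by omega))
      (hDfin.insert g)
    exact inMinorTogether_wheelMatroidTwo_of_mem hE hxF hF hr hrF hDF hDr hD heD (hDd e heD)
      (a := g) (b := b) ⟨hg, hne heD⟩ ⟨hb, fun h => hbD (Or.inr h)⟩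
      (fun h => hbD (Or.inl h.symm)) (by simp) (by simp)
  by_cases heD : e ∈ D
  · exact key e g he hg heg hne heD
  by_cases hgD : g ∈ D
  · exact (key g e hg he heg.symm (fun _ => heD) hgD).symm
  obtain ⟨d, hd⟩ : D.Nonempty := by
    rw [nonempty_iff_ne_empty]
    rintro rfl
    rw [insert_empty_eq, hx] at hD
    simp at hD
  exact inMinorTogether_wheelMatroidTwo_of_mem hE hxF hF hr hrF hDF hDr hD hd (hDd d hd)
    (a := e) (b := g) ⟨he, heD⟩ ⟨hg, hgD⟩ heg (by simp) (by simp)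

end SingleElementExtension

/-! ### Both matroids have the transitivity property. -/

section Sufficiency

variable {β : Type v} {M : Matroid β} {e g : β}

theorem IsConnected.inMinorTogether_of_isUniform_delete [M.Finite] (h : IsConnected M)
    (hM : ¬ IsUniform M) {x : β} (hx : x ∈ M.E) (he : e ∈ M.E) (hg : g ∈ M.E) (heg : e ≠ g)
    (hex : e ≠ x) (hgx : g ≠ x) (hc : IsConnected (M ＼ {x})) (hu : IsUniform (M ＼ {x})) :
    InMinorTogether wheelMatroidTwo M e g := by
  obtain ⟨F, hF⟩ : ∃ F, F = M.E \ {x} := ⟨_, rfl⟩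
  obtain ⟨r, hr⟩ : ∃ r, r = rk M M.E := ⟨_, rfl⟩
  have hFE : F ⊆ M.E := hF ▸ sdiff_subset
  have hFfin : F.Finite := M.ground_finite.subset hFE
  have hxF : x ∉ F := fun h => (hF ▸ h : x ∈ M.E \ {x}).2 rfl
  have hE : M.E = insert x F := by rw [hF, insert_sdiff_singleton, insert_eq_of_mem hx]
  have hmF : (M ＼ {x}).E = F := hF.symm
  have hfin : (M ＼ {x}).Finite := minor_finite (delete_isMinor M {x})
  have hm : ∀ X ⊆ F, rk (M ＼ {x}) X = rk M X := fun X hX => by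
    rw [rk_delete, sdiff_singleton_eq_self fun h => hxF (hX h)]
  have hrF : rk M F = r := by rw [hF, hr]; exact h.rk_sdiff_singleton hx he hex.symm
  have hX : ∀ X ⊆ F, rk M X = min X.ncard r := by
    intro X hX
    have h1 := hu X (hmF ▸ hX)
    rw [hmF, hm X hX, hm F Subset.rfl, hrF] at h1
    have h2 := rk_le_ncard M (hFfin.subset hX)
    have h3 := rk_mono M hX
    omega
  have heF : e ∈ F := hF ▸ ⟨he, hex⟩
  have hgF : g ∈ F := hF ▸ ⟨hg, hgx⟩
  -- A connected matroid with two elements is not free.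
  have hlt : r < F.ncard := by
    have h1 := hc {e} (by rw [hmF]; exact singleton_subset_iff.2 heF) (singleton_nonempty e)
      ⟨g, hmF ▸ hgF, heg.symm⟩
    rw [hmF, hm F Subset.rfl, hrF, hm _ (singleton_subset_iff.2 heF), hm _ sdiff_subset] at h1
    have h2 := rk_singleton_le M e
    have h3 := rk_le_ncard M (hFfin.subset (sdiff_subset (s := F) (t := {e})))
    have h4 := ncard_sdiff_singleton_add_one heF hFfin
    omega
  unfold IsUniform at hM
  push Not at hM
  -- A set that is neither independent nor spanning must use `x`, as the deletion is uniform; the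
  -- rest of it is a small set spanning `x`.
  obtain ⟨Y, hY, hY1, hY2⟩ := hM
  have hYfin : Y.Finite := M.ground_finite.subset hY
  have hY3 := rk_le_ncard M hYfin
  have hY4 := rk_mono M hY
  have hDF : Y \ {x} ⊆ F := by
    rw [hF]; exact sdiff_subset_sdiff_left hY
  have h1 := hX _ hDF
  have hxY : x ∈ Y := by
    by_contra hxY
    rw [sdiff_singleton_eq_self hxY] at h1
    omega
  have h2 := rk_mono M (sdiff_subset (s := Y) (t := {x}))
  have h3 := ncard_sdiff_singleton_add_one hxY hYfin
  refine inMinorTogether_wheelMatroidTwo_of_uniform hE hxF hX hr.symm hlt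
    (h.rk_singleton hx he hex.symm) hDF (by omega) ?_ heF hgF heg
  rw [insert_sdiff_singleton, insert_eq_of_mem hxY]
  omega

theorem IsConnected.inMinorTogether_wheelMatroidTwo [M.Finite] (h : IsConnected M)
    (hM : ¬ IsUniform M) (he : e ∈ M.E) (hg : g ∈ M.E) (heg : e ≠ g) :
    InMinorTogether wheelMatroidTwo M e g := by
  induction hn : M.E.ncard using Nat.strong_induction_on generalizing M with
  | _ n ih =>
  have hE : ¬ M.E ⊆ {e, g} := by
    intro hE
    refine hM fun X hX => ?_
    have h1 := h.rk_singleton he hg heg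
    have h2 := h.rk_singleton hg he heg.symm
    rcases subset_pair_iff_eq.1 (hX.trans hE) with rfl | rfl | rfl | rfl
    · simp
    · simp [h1]
    · simp [h2]
    · rw [hE.antisymm hX]; exact Or.inr rfl
  obtain ⟨x, hx, hxe⟩ := not_subset.1 hE
  simp only [mem_insert_iff, mem_singleton_iff, not_or] at hxe
  -- Stated for any `L` on the same ground set so that it also serves for `M✶` when only the
  -- contraction of `x` is connected.
  have key : ∀ L : Matroid β, L.Finite → IsConnected L → ¬ IsUniform L → L.E = M.E →
      IsConnected (L ＼ {x}) → InMinorTogether wheelMatroidTwo L e g := by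
    intro L hL hc hu hLE hcx
    by_cases hux : IsUniform (L ＼ {x})
    · exact hc.inMinorTogether_of_isUniform_delete hu (hLE ▸ hx) (hLE ▸ he) (hLE ▸ hg) heg
        (Ne.symm hxe.1) (Ne.symm hxe.2) hcx hux
    · have hfin : (L ＼ {x}).Finite := minor_finite (delete_isMinor L {x})
      have hEx : (L ＼ {x}).E = M.E \ {x} := by rw [delete_ground, hLE]
      obtain ⟨M', hM', h'⟩ := ih (M.E \ {x}).ncard
        (by rw [← hn]; exact ncard_sdiff_singleton_lt_of_mem hx M.ground_finite) hcx hux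
        (by rw [hEx]; exact ⟨he, Ne.symm hxe.1⟩) (by rw [hEx]; exact ⟨hg, Ne.symm hxe.2⟩)
        (by rw [hEx])
      exact ⟨M', hM'.trans (delete_isMinor L {x}), h'⟩
  rcases h.delete_or_contract x with hx' | hx'
  · exact key M inferInstance h hM rfl hx'
  · have hfin : (M ／ {x}).Finite := minor_finite (contract_isMinor M {x})
    have h1 := key M✶ inferInstance h.dual (fun hu => hM (by simpa using hu.dual)) rfl
      (by rw [← dual_contract]; exact hx'.dual)
    have h2 := h1.dual
    rw [dual_dual] at h2
    exact h2.congr isIso_dual_wheelMatroidTwo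

theorem uniformMatroid_isConnected : IsConnected (uniformMatroid 1 2) := by
  intro A hA ⟨a, ha⟩ ⟨b, hb⟩
  have hs : ∀ i X, i ∈ X → 1 ≤ rk (uniformMatroid 1 2) X := fun i X h => by
    rw [← ncard_singleton i]
    exact ncard_le_rk _ (uniformMatroid_indep_iff.2 (by rw [ncard_singleton]))
      (singleton_subset_iff.2 h)
  have h1 := hs a A ha
  have h2 := hs b _ hb
  obtain ⟨I, -, hI, -, hc⟩ := exists_indep_ncard (uniformMatroid 1 2) (uniformMatroid 1 2).E
  have h3 := uniformMatroid_indep_iff.1 hI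
  omega

theorem hasTransitivityProperty_uniformMatroid :
    HasTransitivityProperty.{0, v} (uniformMatroid 1 2) :=
  hasTransitivityProperty_of_isConnected inferInstance uniformMatroid_isConnected
    fun _ _ _ h _ _ _ he hg heg => h.inMinorTogether_uniformMatroid he hg heg

theorem hasTransitivityProperty_wheelMatroidTwo :
    HasTransitivityProperty.{0, v} wheelMatroidTwo := by
  refine hasTransitivityProperty_of_isConnected inferInstance wheelMatroidTwo_isConnected ?_
  rintro β M hM h ⟨M', hM', hI⟩ e g he hg heg
  have : M'.Finite := minor_finite hM'
  exact h.inMinorTogether_wheelMatroidTwo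
    (fun hu => not_isUniform_of_isIso_wheelMatroidTwo hI (hu.isMinor hM')) he hg heg

end Sufficiency

end MinorTransitivity

/-! ### The characterization. -/

theorem theorem1p2 {α : Type u} (N : Matroid α) (hfin : N.Finite) (hcard : 2 ≤ N.E.encard) :
    MinorTransitivity.HasTransitivityProperty.{u, v} N ↔
      MinorTransitivity.IsIso N (MinorTransitivity.uniformMatroid 1 2) ∨
      MinorTransitivity.IsIso N MinorTransitivity.wheelMatroidTwo := by
  constructor
  · intro h
    -- The test matroids are built from the ground type of `N`, so a copy of `N` is first placed in
    -- the universe over which transitivity quantifies.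
    obtain ⟨δ, hδ, L, hLE, hL⟩ := MinorTransitivity.exists_isIso_univ.{u, v} N
    have hnt : Nontrivial δ := by
      obtain ⟨φ, -⟩ := hL
      obtain ⟨a, b, ha, hb, hab⟩ := Set.one_lt_encard_iff.1
        (lt_of_lt_of_le (by norm_num : (1 : ℕ∞) < 2) hcard)
      exact ⟨φ ⟨a, ha⟩, φ ⟨b, hb⟩, fun e => hab (by simpa using φ.injective (Subtype.ext e))⟩
    exact ((h.congr hL).isIso hLE).imp hL.trans hL.trans
  · rintro (h | h)
    · exact MinorTransitivity.hasTransitivityProperty_uniformMatroid.congr h.symm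
    · exact MinorTransitivity.hasTransitivityProperty_wheelMatroidTwo.congr h.symm
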